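/- **Setting.** Let $k$ be an algebraically closed field. *Linear logic* means first-order intuitionistic linear logic with connectives $\otimes, \&, \multimap, {!}$ over a set of atoms. Its rules are axiom, exchange, cut, left and right introduction for $\otimes, \&, \multimap$, and promotion, dereliction, contraction and weakening for ${!}$. Two proofs of a sequent are *equivalent under cut-elimination* if they are identified by the congruence generated by the cut-elimination transformations, including the promotion/promotion rule and the $\eta$-expansions of axioms, with applications of the exchange rule treated as bookkeeping. A *proof of a formula* $A$ is a proof of $\vdash A$, and sets of proofs of a formula always consist of proofs modulo this equivalence. *Sweedler semantics.* Given a choice of $k$-vector spaces for the atoms, put $$[\![A\otimes B]\!]=[\![A]\!]\otimes[\![B]\!],\quad [\![A\,\&\,B]\!]=[\![A]\!]\oplus[\![B]\!],\quad [\![A\multimap B]\!]=\operatorname{Hom}_k([\![A]\!],[\![B]\!]),\quad [\![{!}A]\!]={!}[\![A]\!],$$ where ${!}V$ is the universal cocommutative coassociative counital coalgebra with a linear map $d:{!}V\to V$. A proof $\psi$ of $C_1,\dots,C_s\vdash B$ denotes a linear map $[\![\psi]\!]:[\![C_1]\!]\otimes\dots\otimes[\![C_s]\!]\to[\![B]\!]$;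 dereliction is interpreted by $d$, contraction by the comultiplication, weakening by the counit, and promotion of a proof of ${!}\Gamma\vdash A$ by the coalgebra morphism $[\![{!}\Gamma]\!]\to{!}[\![A]\!]$ lifting its denotation. Equivalent proofs have equal denotations. In particular a proof $\rho$ of $A$ has a denotation $[\![\rho]\!]\in[\![A]\!]$, and for a finite set $\mathcal P$ of proofs of $A$ there is an induced linear map $[\![-]\!]:k\mathcal P\to[\![A]\!]$ on the free vector space $k\mathcal P$. For $P\in V$ let $|\emptyset\rangle_P\in{!}V$ be the image of $1$ under the coalgebra morphism $k\to{!}V$ lifting the linear map $k\to V$, $1\mapsto P$; it is group-like and $d|\emptyset\rangle_P=P$. *Plain proofs.* Let $r\ge 0$ and $n_1,\dots,n_r\ge 0$. A proof $\psi$ of ${!}A_1,\dots,{!}A_r\vdash B$ is *plain*, constructed from a proof $\pi$ of $n_1A_1,\dots,n_rA_r\vdash B$ (where $n_iA_i$ means $n_i$ copies of the hypothesis $A_i$), if it is equivalent under cut-elimination to a proof obtained from $\pi$ by a dereliction at each copy of each $A_i$, followed, for each $i$, by contractions of the $n_i$ copies of ${!}A_i$ into one if $n_i\geq 1$, or by a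 weakening introducing ${!}A_i$ if $n_i=0$. For families $X_i=(X_{i1},\dots,X_{in_i})$ of proofs of $A_i$, let $\pi(X_1,\dots,X_r)$ be the proof of $B$ obtained by cutting $\pi$ against all the $X_{ij}$. **Proposition.** Let $\psi$ be a plain proof of ${!}A_1,\dots,{!}A_r\vdash B$ constructed from $\pi$ as above. Let $\mathcal P_i$ ($1\le i\le r$) be finite sets of proofs of $A_i$ and $\mathcal Q$ a finite set of proofs of $B$ such that $\pi(X_1,\dots,X_r)\in\mathcal Q$ whenever $X_i\in\mathcal P_i^{n_i}$ for all $i$, and such that the family $([\![\nu]\!])_{\nu\in\mathcal Q}$ is linearly independent in $[\![B]\!]$. Let $$\iota:\prod_{i=1}^r k\mathcal P_i\to\bigotimes_{i=1}^r{!}[\![A_i]\!],\qquad \iota(\omega_1,\dots,\omega_r)=|\emptyset\rangle_{[\![\omega_1]\!]}\otimes\dots\otimes|\emptyset\rangle_{[\![\omega_r]\!]}.$$ Then there is a unique function $F_\psi:k\mathcal P_1\times\dots\times k\mathcal P_r\to k\mathcal Q$ with $[\![\psi]\!]\circ\iota=[\![-]\!]\circ F_\psi$. Moreover $F_\psi$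 is polynomial: write $\operatorname{Sym}(k\mathcal Q)=k[y_\tau]_{\tau\in\mathcal Q}$ and $\operatorname{Sym}(k\mathcal P_1\oplus\dots\oplus k\mathcal P_r)=k[x^i_\rho]_{1\le i\le r,\,\rho\in\mathcal P_i}$. Then $F_\psi$ is induced by the morphism of $k$-algebras $$f_\psi:\operatorname{Sym}(k\mathcal Q)\to\operatorname{Sym}(k\mathcal P_1\oplus\dots\oplus k\mathcal P_r),\qquad f_\psi(y_\tau)=f_\psi^\tau:=\sum_{\gamma_1,\dots,\gamma_r}\delta_{\tau=\pi(\gamma_1,\dots,\gamma_r)}\prod_{i=1}^r\prod_{j=1}^{n_i}x^i_{\gamma_i(j)},$$ where $\gamma_i$ ranges over all functions $\{1,\dots,n_i\}\to\mathcal P_i$. Here "induced" means that for every $a=(a^i_\rho)\in\prod_i k\mathcal P_i$ and every $g \in \operatorname{Sym}(k\mathcal Q)$ the value of $g$ at the point $F_\psi(a)$ is the value of $f_\psi(g)$ at $a$; in particular the $\tau$-coordinate of $F_\psi(a)$ is $f_\psi^\tau|_{x^i_\rho=a^i_\rho}$. -/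

import Mathlib

universe u v w

open scoped TensorProduct

namespace LinearLogic

section Cofree

variable {k : Type u} [Field k]
variable {V : Type u} [AddCommGroup V] [Module k V]

/-- For a coalgebra `C`, a linear map `f : C → V` and a word `w = φ₁ ⋯ φₙ` of functionals on `V`, the
functional `(φ₁ ⊗ ⋯ ⊗ φₙ) ∘ f^{⊗ n} ∘ Δ^{n-1}` on `C` (which is the counit for `n = 0`). -/
noncomputable def wordCoeff {C : Type u} [AddCommGroup C] [Module k C] [Coalgebra k C]
    (f : C →ₗ[k] V) : List (Module.Dual k V) → (C →ₗ[k] k)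
  | [] => Coalgebra.counit
  | φ :: w => LinearMap.mul' k k ∘ₗ TensorProduct.map (φ ∘ₗ f) (wordCoeff f w) ∘ₗ Coalgebra.comul

theorem wordCoeff_eq_prod {C : Type u} [AddCommGroup C] [Module k C] [Coalgebra k C]
    (f : C →ₗ[k] V) (w : List (Module.Dual k V)) :
    WithConv.toConv (wordCoeff f w) = (w.map fun φ => WithConv.toConv (φ ∘ₗ f)).prod := by
  induction w with
  | nil => simp only [wordCoeff, List.map_nil, List.prod_nil]; rfl
  | cons φ w ih => rw [List.map_cons, List.prod_cons, ← ih]; rfl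

theorem wordCoeff_append {C : Type u} [AddCommGroup C] [Module k C] [Coalgebra k C]
    (f : C →ₗ[k] V) (w w' : List (Module.Dual k V)) :
    wordCoeff f (w ++ w') =
      LinearMap.mul' k k ∘ₗ TensorProduct.map (wordCoeff f w) (wordCoeff f w') ∘ₗ
        Coalgebra.comul := by
  apply WithConv.toConv_injective
  rw [wordCoeff_eq_prod, List.map_append, List.prod_append, ← wordCoeff_eq_prod,
    ← wordCoeff_eq_prod]
  rfl

theorem wordCoeff_comp {C D : Type u} [AddCommGroup C] [Module k C] [Coalgebra k C]
    [AddCommGroup D] [Module k D] [Coalgebra k D] (h : C →ₗc[k] D) (f : D →ₗ[k] V)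
    (w : List (Module.Dual k V)) :
    wordCoeff (f ∘ₗ h.toLinearMap) w = wordCoeff f w ∘ₗ h.toLinearMap := by
  induction w with
  | nil => simp [wordCoeff]
  | cons φ w ih =>
    simp only [wordCoeff, ih]
    rw [show φ ∘ₗ f ∘ₗ h.toLinearMap = (φ ∘ₗ f) ∘ₗ h.toLinearMap from rfl, TensorProduct.map_comp]
    simp only [LinearMap.comp_assoc]
    rw [h.map_comp_comul]

variable (k V) in
/-- The universal cocommutative coalgebra `!V`, as a space of functions on words of functionals on
`V`: it consists of the functions `w ↦ wordCoeff f w c`, where `c` is an element of a cocommutative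
coalgebra `C` and `f : C → V` is linear.  See `existsUnique_coalgHom` for the universal property. -/
noncomputable def bangSubmodule : Submodule k (List (Module.Dual k V) → k) where
  carrier := {x | ∃ (C : Type u) (_ : AddCommGroup C) (_ : Module k C) (_ : Coalgebra k C)
    (_ : Coalgebra.IsCocomm k C) (f : C →ₗ[k] V) (c : C), x = fun w => wordCoeff f w c}
  zero_mem' := ⟨k, inferInstance, inferInstance, inferInstance, inferInstance, 0, 0, by
    funext w; simp⟩
  smul_mem' := by
    rintro a _ ⟨C, i1, i2, i3, i4, f, c, rfl⟩
    exact ⟨C, i1, i2, i3, i4, f, a • c, by funext w; simp⟩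
  add_mem' := by
    rintro _ _ ⟨C, i1, i2, i3, i4, f, c, rfl⟩ ⟨D, j1, j2, j3, j4, g, d, rfl⟩
    refine ⟨C × D, inferInstance, inferInstance, inferInstance, inferInstance,
      f.coprod g, (c, d), ?_⟩
    funext w
    have hl : (f.coprod g) ∘ₗ LinearMap.inl k C D = f := by ext; simp
    have hr : (f.coprod g) ∘ₗ LinearMap.inr k C D = g := by ext; simp
    have el : wordCoeff (f.coprod g) w (c, 0) = wordCoeff f w c := by
      have := wordCoeff_comp (k := k) (V := V)
        ({ LinearMap.inl k C D with
            counit_comp := by ext; simp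
            map_comp_comul := by ext; simp } : C →ₗc[k] C × D) (f.coprod g) w
      have h2 := LinearMap.congr_fun this c
      simpa [hl] using h2.symm
    have er : wordCoeff (f.coprod g) w (0, d) = wordCoeff g w d := by
      have := wordCoeff_comp (k := k) (V := V)
        ({ LinearMap.inr k C D with
            counit_comp := by ext; simp
            map_comp_comul := by ext; simp } : D →ₗc[k] C × D) (f.coprod g) w
      have h2 := LinearMap.congr_fun this d
      simpa [hr] using h2.symm
    rw [Pi.add_apply, ← el, ← er, ← map_add]
    simp

variable (k V) in
/-- The universal cocommutative coassociative counital coalgebra `!V` mapping to `V`. -/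
abbrev Bang : Type u := ↥(bangSubmodule k V)

namespace Bang

section lift

variable {C : Type u} [AddCommGroup C] [Module k C] [Coalgebra k C] [Coalgebra.IsCocomm k C]

/-- The underlying linear map of the coalgebra morphism `C → !V` induced by `f : C → V`. -/
noncomputable def lift (f : C →ₗ[k] V) : C →ₗ[k] Bang k V :=
  LinearMap.codRestrict (bangSubmodule k V) (LinearMap.pi (wordCoeff f))
    fun c => ⟨C, inferInstance, inferInstance, inferInstance, inferInstance, f, c, rfl⟩

theorem lift_apply (f : C →ₗ[k] V) (c : C) (w : List (Module.Dual k V)) :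
    (lift f c).1 w = wordCoeff f w c := rfl

end lift

theorem exists_lift (x : Bang k V) : ∃ (C : Type u) (_ : AddCommGroup C) (_ : Module k C)
    (_ : Coalgebra k C) (_ : Coalgebra.IsCocomm k C) (f : C →ₗ[k] V) (c : C), lift f c = x := by
  obtain ⟨C, i1, i2, i3, i4, f, c, h⟩ := x.2
  exact ⟨C, i1, i2, i3, i4, f, c, Subtype.ext h.symm⟩

/-- The value of `x ⊗ y` at a pair of words. -/
noncomputable def pairEval (w w' : List (Module.Dual k V)) : Bang k V ⊗[k] Bang k V →ₗ[k] k :=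
  LinearMap.mul' k k ∘ₗ TensorProduct.map
    (LinearMap.proj w ∘ₗ (bangSubmodule k V).subtype)
    (LinearMap.proj w' ∘ₗ (bangSubmodule k V).subtype)

theorem pairEval_ext {s t : Bang k V ⊗[k] Bang k V}
    (h : ∀ w w', pairEval w w' s = pairEval w w' t) : s = t := by
  classical
  rw [← sub_eq_zero]
  have h0 : ∀ w w', pairEval w w' (s - t) = 0 := fun w w' => by rw [map_sub, h, sub_self]
  generalize s - t = z at h0
  let b := Module.Basis.ofVectorSpace k (Bang k V)
  obtain ⟨c, rfl⟩ := (TensorProduct.equivFinsuppOfBasisRight b (M := Bang k V)).symm.surjective z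
  suffices c = 0 by rw [this, map_zero]
  ext1 i
  apply Subtype.ext
  funext w
  have hz : (c.sum fun j x => x.1 w • b j) = 0 := by
    apply Subtype.ext
    funext w'
    have := h0 w w'
    rw [TensorProduct.equivFinsuppOfBasisRight_symm_apply, Finsupp.sum, map_sum] at this
    simp only [pairEval, LinearMap.comp_apply, TensorProduct.map_tmul] at this
    rw [Finsupp.sum]
    simpa [Finset.sum_apply] using this
  have h3 := congrArg (fun v => b.repr v i) hz
  rw [Finsupp.sum] at h3
  simp only [map_sum, map_smul, Module.Basis.repr_self, Finsupp.coe_finsetSum, Finset.sum_apply,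
    Finsupp.smul_apply, Finsupp.single_apply, smul_eq_mul, mul_ite, mul_one, mul_zero,
    map_zero, Finsupp.zero_apply, Finset.sum_ite_eq', Finsupp.mem_support_iff] at h3
  by_cases hi : c i = 0
  · simp [hi]
  · simpa [hi] using h3

theorem exists_comul (x : Bang k V) : ∃ t : Bang k V ⊗[k] Bang k V,
    ∀ w w', pairEval w w' t = x.1 (w ++ w') := by
  obtain ⟨C, i1, i2, i3, i4, f, c, rfl⟩ := exists_lift x
  refine ⟨TensorProduct.map (lift f) (lift f) (Coalgebra.comul (R := k) c), fun w w' => ?_⟩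
  rw [lift_apply, wordCoeff_append, pairEval, LinearMap.comp_apply, LinearMap.comp_apply,
    LinearMap.comp_apply, ← LinearMap.comp_apply (TensorProduct.map _ _) (TensorProduct.map _ _),
    ← TensorProduct.map_comp]
  rfl

theorem exists_point (x : Bang k V) : ∃ p : V, ∀ φ : Module.Dual k V, φ p = x.1 [φ] := by
  obtain ⟨C, i1, i2, i3, i4, f, c, rfl⟩ := exists_lift x
  refine ⟨f c, fun φ => ?_⟩
  rw [lift_apply]
  have h := congrArg (fun g => (WithConv.ofConv g) c) (wordCoeff_eq_prod (k := k) f [φ])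
  simpa using h.symm

variable (k V) in
/-- The universal map `d : !V → V`; it is determined by `φ (d x) = x [φ]` for all functionals `φ`. -/
noncomputable def d : Bang k V →ₗ[k] V where
  toFun x := (exists_point x).choose
  map_add' x y := by
    rw [← sub_eq_zero, ← Module.forall_dual_apply_eq_zero_iff k]
    intro φ
    simp [(exists_point (x + y)).choose_spec, (exists_point x).choose_spec,
      (exists_point y).choose_spec]
  map_smul' a x := by
    rw [← sub_eq_zero, ← Module.forall_dual_apply_eq_zero_iff k]
    intro φ
    simp [(exists_point (a • x)).choose_spec, (exists_point x).choose_spec]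

theorem apply_d (φ : Module.Dual k V) (x : Bang k V) : φ (d k V x) = x.1 [φ] :=
  (exists_point x).choose_spec φ

/-- The comultiplication is dual to the concatenation of words. -/
noncomputable instance : CoalgebraStruct k (Bang k V) where
  comul :=
    { toFun x := (exists_comul x).choose
      map_add' x y := pairEval_ext fun w w' => by
        simp [(exists_comul (x + y)).choose_spec, (exists_comul x).choose_spec,
          (exists_comul y).choose_spec]
      map_smul' a x := pairEval_ext fun w w' => by
        simp [(exists_comul (a • x)).choose_spec, (exists_comul x).choose_spec] }
  counit := LinearMap.proj [] ∘ₗ (bangSubmodule k V).subtype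

theorem pairEval_comul (x : Bang k V) (w w' : List (Module.Dual k V)) :
    pairEval w w' (CoalgebraStruct.comul (R := k) x) = x.1 (w ++ w') :=
  (exists_comul x).choose_spec w w'

variable {C : Type u} [AddCommGroup C] [Module k C] [Coalgebra k C] [Coalgebra.IsCocomm k C]

theorem comul_comp_lift (f : C →ₗ[k] V) :
    CoalgebraStruct.comul (R := k) ∘ₗ lift f =
      TensorProduct.map (lift f) (lift f) ∘ₗ CoalgebraStruct.comul := by
  ext c
  apply pairEval_ext
  intro w w'
  rw [LinearMap.comp_apply, pairEval_comul, lift_apply, wordCoeff_append, pairEval]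
  simp only [LinearMap.comp_apply]
  rw [← LinearMap.comp_apply (TensorProduct.map _ _) (TensorProduct.map _ _),
    ← TensorProduct.map_comp]
  rfl

theorem counit_comp_lift (f : C →ₗ[k] V) :
    CoalgebraStruct.counit (R := k) ∘ₗ lift f = CoalgebraStruct.counit := rfl

theorem d_comp_lift (f : C →ₗ[k] V) : d k V ∘ₗ lift f = f := by
  ext c
  rw [← sub_eq_zero, ← Module.forall_dual_apply_eq_zero_iff k]
  intro φ
  have h := congrArg (fun g => (WithConv.ofConv g) c) (wordCoeff_eq_prod (k := k) f [φ])
  rw [map_sub, LinearMap.comp_apply, apply_d, lift_apply, sub_eq_zero]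
  simpa using h

theorem comul_lift (f : C →ₗ[k] V) (c : C) :
    CoalgebraStruct.comul (R := k) (lift f c) =
      TensorProduct.map (lift f) (lift f) (CoalgebraStruct.comul (R := k) c) :=
  LinearMap.congr_fun (comul_comp_lift f) c

noncomputable instance : Coalgebra k (Bang k V) where
  coassoc := by
    ext1 x
    obtain ⟨C, i1, i2, i3, i4, f, c, rfl⟩ := exists_lift x
    simp only [LinearMap.comp_apply, comul_lift, LinearEquiv.coe_coe]
    have h1 : ∀ t : C ⊗[k] C, TensorProduct.assoc k _ _ _
          (LinearMap.rTensor (Bang k V) CoalgebraStruct.comul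
            (TensorProduct.map (lift f) (lift f) t)) =
        TensorProduct.map (lift f) (TensorProduct.map (lift f) (lift f))
          (TensorProduct.assoc k _ _ _ (LinearMap.rTensor C CoalgebraStruct.comul t)) := by
      intro t
      have h := LinearMap.congr_fun (TensorProduct.map_map_comp_assoc_eq (R := k) (lift f) (lift f)
        (lift f)) (LinearMap.rTensor C CoalgebraStruct.comul t)
      rw [← LinearMap.comp_apply (LinearMap.rTensor _ _), LinearMap.rTensor_comp_map,
        comul_comp_lift, ← LinearMap.map_comp_rTensor]
      exact h.symm
    have h2 : ∀ t : C ⊗[k] C, LinearMap.lTensor (Bang k V) CoalgebraStruct.comul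
            (TensorProduct.map (lift f) (lift f) t) =
        TensorProduct.map (lift f) (TensorProduct.map (lift f) (lift f))
          (LinearMap.lTensor C CoalgebraStruct.comul t) := by
      intro t
      rw [← LinearMap.comp_apply (LinearMap.lTensor _ _), LinearMap.lTensor_comp_map,
        comul_comp_lift, ← LinearMap.comp_apply (TensorProduct.map _ _) (LinearMap.lTensor _ _),
        LinearMap.map_comp_lTensor]
    rw [h1, h2, Coalgebra.coassoc_apply]
  rTensor_counit_comp_comul := by
    ext1 x
    obtain ⟨C, i1, i2, i3, i4, f, c, rfl⟩ := exists_lift x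
    rw [LinearMap.comp_apply, comul_lift, ← LinearMap.comp_apply, LinearMap.rTensor_comp_map,
      counit_comp_lift]
    have h := congrArg (LinearMap.lTensor k (lift f)) (Coalgebra.rTensor_counit_comul (R := k) c)
    rw [← LinearMap.comp_apply, LinearMap.lTensor_comp_rTensor] at h
    simpa using h
  lTensor_counit_comp_comul := by
    ext1 x
    obtain ⟨C, i1, i2, i3, i4, f, c, rfl⟩ := exists_lift x
    rw [LinearMap.comp_apply, comul_lift, ← LinearMap.comp_apply, LinearMap.lTensor_comp_map,
      counit_comp_lift]
    have h := congrArg (LinearMap.rTensor k (lift f)) (Coalgebra.lTensor_counit_comul (R := k) c)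
    rw [← LinearMap.comp_apply, LinearMap.rTensor_comp_lTensor] at h
    simpa using h

instance : Coalgebra.IsCocomm k (Bang k V) where
  comm_comp_comul := by
    ext1 x
    obtain ⟨C, i1, i2, i3, i4, f, c, rfl⟩ := exists_lift x
    rw [LinearMap.comp_apply, comul_lift]
    conv_rhs => rw [← Coalgebra.comm_comul k c]
    rw [LinearEquiv.coe_coe, TensorProduct.map_comm]

/-- `lift f` as a morphism of coalgebras. -/
noncomputable def liftHom (f : C →ₗ[k] V) : C →ₗc[k] Bang k V :=
  { lift f with
    counit_comp := counit_comp_lift f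
    map_comp_comul := (comul_comp_lift f).symm }

theorem wordCoeff_d (w : List (Module.Dual k V)) (x : Bang k V) :
    wordCoeff (d k V) w x = x.1 w := by
  obtain ⟨C, i1, i2, i3, i4, f, c, rfl⟩ := exists_lift x
  have h := wordCoeff_comp (liftHom f) (d k V) w
  rw [show d k V ∘ₗ (liftHom f).toLinearMap = f from d_comp_lift f] at h
  exact (LinearMap.congr_fun h c).symm

/-- The universal property of `!V`. -/
theorem existsUnique_coalgHom (f : C →ₗ[k] V) :
    ∃! h : C →ₗc[k] Bang k V, d k V ∘ₗ h.toLinearMap = f := by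
  refine ⟨liftHom f, d_comp_lift f, fun h hh => ?_⟩
  ext c w
  change (h c).1 w = wordCoeff f w c
  rw [← wordCoeff_d, ← hh, wordCoeff_comp]
  rfl

/-- The vacuum vector `|∅⟩_p`: the image of `1` under the coalgebra morphism `k → !V` induced by the
linear map `k → V`, `1 ↦ p`.  It is the group-like element of `!V` lying over `p`. -/
noncomputable def ket (p : V) : Bang k V := lift (LinearMap.toSpanSingleton k V p) 1

theorem d_ket (p : V) : d k V (ket p) = p := by
  have h := LinearMap.congr_fun (d_comp_lift (LinearMap.toSpanSingleton k V p)) 1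
  simpa [ket] using h

theorem isGroupLike_ket (p : V) : IsGroupLikeElem k (ket (k := k) p) where
  counit_eq_one := LinearMap.congr_fun (counit_comp_lift (LinearMap.toSpanSingleton k V p)) 1
  comul_eq_tmul_self := by
    rw [ket, comul_lift]
    simp

end Bang
end Cofree

section Calculus

variable {α : Type v}

/-- Formulas of first-order intuitionistic linear logic with connectives `⊗, &, ⊸, !` over a set `α`
of atoms. -/
inductive Formula (α : Type v) : Type v
  | atom (a : α) : Formula α
  | tensor (A B : Formula α) : Formula α
  | amp (A B : Formula α) : Formula α
  | lolli (A B : Formula α) : Formula α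
  | bang (A : Formula α) : Formula α

/-- Permutations of lists, as data (two equal entries can be exchanged or not). -/
inductive Exch {β : Type w} : List β → List β → Type w
  | nil : Exch [] []
  | cons (a : β) {l l' : List β} (e : Exch l l') : Exch (a :: l) (a :: l')
  | swap (a b : β) (l : List β) : Exch (a :: b :: l) (b :: a :: l)
  | trans {l l' l'' : List β} (e : Exch l l') (e' : Exch l' l'') : Exch l l''

namespace Exch

variable {β : Type w} {γ : Type v}

/-- The bijection of positions underlying a permutation of lists. -/
def pos : ∀ {l l' : List β}, Exch l l' → ℕ → ℕ
  | _, _, nil => id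
  | _, _, cons _ e => fun m => Nat.casesOn m 0 fun m => e.pos m + 1
  | _, _, swap _ _ _ => fun m => if m = 0 then 1 else if m = 1 then 0 else m
  | _, _, trans e e' => e'.pos ∘ e.pos

def refl : ∀ l : List β, Exch l l
  | [] => nil
  | a :: l => cons a (refl l)

def map (f : β → γ) : ∀ {l l' : List β}, Exch l l' → Exch (l.map f) (l'.map f)
  | _, _, nil => nil
  | _, _, cons a e => cons (f a) (e.map f)
  | _, _, swap a b l => swap (f a) (f b) (l.map f)
  | _, _, trans e e' => trans (e.map f) (e'.map f)

def appendRight : ∀ {l l' : List β}, Exch l l' → ∀ m : List β, Exch (l ++ m) (l' ++ m)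
  | _, _, nil, m => refl m
  | _, _, cons a e, m => cons a (e.appendRight m)
  | _, _, swap a b l, m => swap a b (l ++ m)
  | _, _, trans e e', m => trans (e.appendRight m) (e'.appendRight m)

def appendLeft : ∀ (l : List β) {m m' : List β}, Exch m m' → Exch (l ++ m) (l ++ m')
  | [], _, _, e => e
  | a :: l, _, _, e => cons a (appendLeft l e)

def append {l l' m m' : List β} (e : Exch l l') (e' : Exch m m') : Exch (l ++ m) (l' ++ m') :=
  trans (e.appendRight m) (appendLeft l' e')

/-- Move the first entry behind the block `l`. -/
def bubble (a : β) : ∀ l m : List β, Exch (a :: (l ++ m)) (l ++ a :: m)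
  | [], m => refl (a :: m)
  | b :: l, m => trans (swap a b (l ++ m)) (cons b (bubble a l m))

/-- Exchange the adjacent blocks `l₁` and `l₂`. -/
def blocks : ∀ l₁ l₂ l₃ : List β, Exch (l₁ ++ (l₂ ++ l₃)) (l₂ ++ (l₁ ++ l₃))
  | [], l₂, l₃ => refl (l₂ ++ l₃)
  | a :: l₁, l₂, l₃ => trans (cons a (blocks l₁ l₂ l₃)) (bubble a l₂ (l₁ ++ l₃))

end Exch

open Formula

/-- Proofs of sequents `Γ ⊢ A` in the sequent calculus. -/
inductive Prf : List (Formula α) → Formula α → Type v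
  | ax (A : Formula α) : Prf [A] A
  | exch {Γ Δ : List (Formula α)} {A : Formula α} (e : Exch Γ Δ) (p : Prf Γ A) : Prf Δ A
  | cut {Γ Δ : List (Formula α)} {A B : Formula α} (p : Prf Γ A) (q : Prf (A :: Δ) B) :
      Prf (Γ ++ Δ) B
  | tensorR {Γ Δ : List (Formula α)} {A B : Formula α} (p : Prf Γ A) (q : Prf Δ B) :
      Prf (Γ ++ Δ) (tensor A B)
  | tensorL {Γ : List (Formula α)} {A B C : Formula α} (p : Prf (A :: B :: Γ) C) :
      Prf (tensor A B :: Γ) C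
  | lolliR {Γ : List (Formula α)} {A B : Formula α} (p : Prf (A :: Γ) B) : Prf Γ (lolli A B)
  | lolliL {Γ Δ : List (Formula α)} {A B C : Formula α} (p : Prf Γ A) (q : Prf (B :: Δ) C) :
      Prf (lolli A B :: (Γ ++ Δ)) C
  | ampR {Γ : List (Formula α)} {A B : Formula α} (p : Prf Γ A) (q : Prf Γ B) : Prf Γ (amp A B)
  | ampL0 {Γ : List (Formula α)} {A C : Formula α} (B : Formula α) (p : Prf (A :: Γ) C) :
      Prf (amp A B :: Γ) C
  | ampL1 {Γ : List (Formula α)} {B C : Formula α} (A : Formula α) (p : Prf (B :: Γ) C) :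
      Prf (amp A B :: Γ) C
  | prom {Γ : List (Formula α)} {A : Formula α} (p : Prf (Γ.map bang) A) :
      Prf (Γ.map bang) (bang A)
  | der {Γ : List (Formula α)} {A B : Formula α} (p : Prf (A :: Γ) B) : Prf (bang A :: Γ) B
  | ctr {Γ : List (Formula α)} {A B : Formula α} (p : Prf (bang A :: bang A :: Γ) B) :
      Prf (bang A :: Γ) B
  | wk {Γ : List (Formula α)} {B : Formula α} (A : Formula α) (p : Prf Γ B) : Prf (bang A :: Γ) B

namespace Prf

/-- Transport of a proof along an equality of contexts. -/
def cast {Γ Δ : List (Formula α)} {A : Formula α} (h : Γ = Δ) (p : Prf Γ A) : Prf Δ A := h ▸ p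

/-- Weakening by all formulas of `!Γ`. -/
def wks {Δ : List (Formula α)} {B : Formula α} (p : Prf Δ B) :
    ∀ Γ : List (Formula α), Prf (Γ.map bang ++ Δ) B
  | [] => p
  | A :: Γ => wk A (wks p Γ)

/-- Contraction of two copies of `!Γ`. -/
def ctrs {B : Formula α} : ∀ (Γ Δ : List (Formula α)),
    Prf (Γ.map bang ++ (Γ.map bang ++ Δ)) B → Prf (Γ.map bang ++ Δ) B
  | [], _, p => p
  | A :: Γ, Δ, p =>
    let q : Prf (bang A :: bang A :: (Γ.map bang ++ (Γ.map bang ++ Δ))) B :=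
      exch (Exch.blocks (bang A :: Γ.map bang) [bang A] (Γ.map bang ++ Δ)) p
    let s : Prf (Γ.map bang ++ (Γ.map bang ++ bang A :: Δ)) B :=
      exch (Exch.appendLeft (Γ.map bang) (Exch.blocks [bang A] (Γ.map bang) Δ))
        (exch (Exch.blocks [bang A] (Γ.map bang) (Γ.map bang ++ Δ)) (ctr q))
    exch (Exch.blocks (Γ.map bang) [bang A] Δ) (ctrs Γ (bang A :: Δ) s)

/-- Elementary transformations of proofs: the cut-elimination steps, the expansions of axioms, and
the rules saying that exchanges are mere bookkeeping. -/
inductive Step : ∀ {Γ : List (Formula α)} {A : Formula α}, Prf Γ A → Prf Γ A → Prop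
  -- exchange
  | exch_refl {Γ : List (Formula α)} {A : Formula α} (p : Prf Γ A) : Step (exch (Exch.refl Γ) p) p
  | exch_trans {Γ Δ Θ : List (Formula α)} {A : Formula α} (e : Exch Γ Δ) (e' : Exch Δ Θ) (p : Prf Γ A) :
      Step (exch e' (exch e p)) (exch (e.trans e') p)
  | exch_pos {Γ Δ : List (Formula α)} {A : Formula α} (e e' : Exch Γ Δ) (h : e.pos = e'.pos) (p : Prf Γ A) :
      Step (exch e p) (exch e' p)
  | exch_cut {Γ Γ' Δ Δ' : List (Formula α)} {A B : Formula α} (e : Exch Γ Γ') (e' : Exch Δ Δ') (p : Prf Γ A) (q : Prf (A :: Δ) B) :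
      Step (cut (exch e p) (exch (e'.cons A) q)) (exch (e.append e') (cut p q))
  | exch_tensorR {Γ Γ' Δ Δ' : List (Formula α)} {A B : Formula α} (e : Exch Γ Γ') (e' : Exch Δ Δ') (p : Prf Γ A) (q : Prf Δ B) :
      Step (tensorR (exch e p) (exch e' q)) (exch (e.append e') (tensorR p q))
  | exch_tensorL {Γ Γ' : List (Formula α)} {A B C : Formula α} (e : Exch Γ Γ') (p : Prf (A :: B :: Γ) C) :
      Step (tensorL (exch ((e.cons B).cons A) p)) (exch (e.cons (tensor A B)) (tensorL p))
  | exch_lolliR {Γ Γ' : List (Formula α)} {A B : Formula α} (e : Exch Γ Γ') (p : Prf (A :: Γ) B) :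
      Step (lolliR (exch (e.cons A) p)) (exch e (lolliR p))
  | exch_lolliL {Γ Γ' Δ Δ' : List (Formula α)} {A B C : Formula α} (e : Exch Γ Γ') (e' : Exch Δ Δ') (p : Prf Γ A)
      (q : Prf (B :: Δ) C) :
      Step (lolliL (exch e p) (exch (e'.cons B) q))
        (exch ((e.append e').cons (lolli A B)) (lolliL p q))
  | exch_ampR {Γ Γ' : List (Formula α)} {A B : Formula α} (e : Exch Γ Γ') (p : Prf Γ A) (q : Prf Γ B) :
      Step (ampR (exch e p) (exch e q)) (exch e (ampR p q))
  | exch_ampL0 {Γ Γ' : List (Formula α)} {A C : Formula α} (B : Formula α) (e : Exch Γ Γ') (p : Prf (A :: Γ) C) :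
      Step (ampL0 B (exch (e.cons A) p)) (exch (e.cons (amp A B)) (ampL0 B p))
  | exch_ampL1 {Γ Γ' : List (Formula α)} {B C : Formula α} (A : Formula α) (e : Exch Γ Γ') (p : Prf (B :: Γ) C) :
      Step (ampL1 A (exch (e.cons B) p)) (exch (e.cons (amp A B)) (ampL1 A p))
  | exch_prom {Γ Γ' : List (Formula α)} {A : Formula α} (e : Exch Γ Γ') (p : Prf (Γ.map bang) A) :
      Step (prom (exch (e.map bang) p)) (exch (e.map bang) (prom p))
  | exch_der {Γ Γ' : List (Formula α)} {A B : Formula α} (e : Exch Γ Γ') (p : Prf (A :: Γ) B) :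
      Step (der (exch (e.cons A) p)) (exch (e.cons (bang A)) (der p))
  | exch_ctr {Γ Γ' : List (Formula α)} {A B : Formula α} (e : Exch Γ Γ') (p : Prf (bang A :: bang A :: Γ) B) :
      Step (ctr (exch ((e.cons (bang A)).cons (bang A)) p)) (exch (e.cons (bang A)) (ctr p))
  | exch_wk {Γ Γ' : List (Formula α)} {B : Formula α} (A : Formula α) (e : Exch Γ Γ') (p : Prf Γ B) :
      Step (wk A (exch e p)) (exch (e.cons (bang A)) (wk A p))
  -- cut against an axiom
  | ax_cut {Δ : List (Formula α)} {A B : Formula α} (q : Prf (A :: Δ) B) : Step (cut (ax A) q) q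
  | cut_ax {Γ : List (Formula α)} {A : Formula α} (p : Prf Γ A) : Step (cut p (ax A)) (p.cast (List.append_nil Γ).symm)
  -- principal cuts
  | tensor_cut {Γ Δ Θ : List (Formula α)} {A B C : Formula α} (p : Prf Γ A) (q : Prf Δ B) (s : Prf (A :: B :: Θ) C) :
      Step (cut (tensorR p q) (tensorL s))
        ((cut (Δ := Δ ++ Θ) p (exch (Exch.blocks Δ [A] Θ) (cut q (exch (Exch.swap A B Θ) s)))).cast
          (List.append_assoc Γ Δ Θ).symm)
  | lolli_cut {Γ Δ Θ : List (Formula α)} {A B C : Formula α} (p : Prf (A :: Γ) B) (q : Prf Δ A) (s : Prf (B :: Θ) C) :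
      Step (cut (lolliR p) (lolliL q s))
        (exch (Exch.blocks Δ Γ Θ) ((cut (cut q p) s).cast (List.append_assoc Δ Γ Θ)))
  | amp_cut0 {Γ Δ : List (Formula α)} {A B C : Formula α} (p : Prf Γ A) (q : Prf Γ B) (s : Prf (A :: Δ) C) :
      Step (cut (ampR p q) (ampL0 B s)) (cut p s)
  | amp_cut1 {Γ Δ : List (Formula α)} {A B C : Formula α} (p : Prf Γ A) (q : Prf Γ B) (s : Prf (B :: Δ) C) :
      Step (cut (ampR p q) (ampL1 A s)) (cut q s)
  | prom_der {Γ Δ : List (Formula α)} {A B : Formula α} (p : Prf (Γ.map bang) A) (q : Prf (A :: Δ) B) :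
      Step (cut (prom p) (der q)) (cut p q)
  | prom_wk {Γ Δ : List (Formula α)} {A B : Formula α} (p : Prf (Γ.map bang) A) (q : Prf Δ B) :
      Step (cut (prom p) (wk A q)) (wks q Γ)
  | prom_ctr {Γ Δ : List (Formula α)} {A B : Formula α} (p : Prf (Γ.map bang) A) (q : Prf (bang A :: bang A :: Δ) B) :
      Step (cut (prom p) (ctr q))
        (ctrs Γ Δ (cut (Δ := Γ.map bang ++ Δ) (prom p)
          (exch (Exch.blocks (Γ.map bang) [bang A] Δ) (cut (prom p) q))))
  | prom_prom {Γ Δ : List (Formula α)} {A B : Formula α} (p : Prf (Γ.map bang) A) (q : Prf ((A :: Δ).map bang) B) :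
      Step (cut (prom p) (prom (Γ := A :: Δ) q))
        ((prom ((cut (prom p) q).cast (List.map_append (l₁ := Γ) (l₂ := Δ)).symm)).cast
          List.map_append)
  -- the last rule above the left premise of the cut is a left rule or a cut
  | cut_left {Γ Δ Θ : List (Formula α)} {A B C : Formula α} (p : Prf Γ A) (q : Prf (A :: Δ) B) (s : Prf (B :: Θ) C) :
      Step (cut (cut p q) s) ((cut p (cut q s)).cast (List.append_assoc Γ Δ Θ).symm)
  | tensorL_left {Γ Δ : List (Formula α)} {A B C D : Formula α} (p : Prf (A :: B :: Γ) C) (s : Prf (C :: Δ) D) :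
      Step (cut (tensorL p) s) (tensorL (cut p s))
  | lolliL_left {Γ Δ Θ : List (Formula α)} {A B C D : Formula α} (p : Prf Γ A) (q : Prf (B :: Δ) C) (s : Prf (C :: Θ) D) :
      Step (cut (lolliL p q) s)
        ((lolliL p (cut q s)).cast
          (congrArg (List.cons (Formula.lolli A B)) (List.append_assoc Γ Δ Θ).symm))
  | ampL0_left {Γ Δ : List (Formula α)} {A C D : Formula α} (B : Formula α) (p : Prf (A :: Γ) C) (s : Prf (C :: Δ) D) :
      Step (cut (ampL0 B p) s) (ampL0 B (cut p s))
  | ampL1_left {Γ Δ : List (Formula α)} {B C D : Formula α} (A : Formula α) (p : Prf (B :: Γ) C) (s : Prf (C :: Δ) D) :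
      Step (cut (ampL1 A p) s) (ampL1 A (cut p s))
  | der_left {Γ Δ : List (Formula α)} {A C D : Formula α} (p : Prf (A :: Γ) C) (s : Prf (C :: Δ) D) :
      Step (cut (der p) s) (der (cut p s))
  | ctr_left {Γ Δ : List (Formula α)} {A C D : Formula α} (p : Prf (bang A :: bang A :: Γ) C) (s : Prf (C :: Δ) D) :
      Step (cut (ctr p) s) (ctr (cut p s))
  | wk_left {Γ Δ : List (Formula α)} {C D : Formula α} (A : Formula α) (p : Prf Γ C) (s : Prf (C :: Δ) D) :
      Step (cut (wk A p) s) (wk A (cut p s))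
  -- the cut formula `X` is not principal in the last rule above the right premise
  | cut_right {Γ Δ Θ : List (Formula α)} {X A B : Formula α} (p : Prf Γ X) (q : Prf Δ A) (s : Prf (X :: A :: Θ) B) :
      Step (cut (Δ := Δ ++ Θ) p (exch (Exch.blocks Δ [X] Θ) (cut q (exch (Exch.swap X A Θ) s))))
        (exch (Exch.blocks Δ Γ Θ) (cut q (exch (Exch.blocks Γ [A] Θ) (cut (Γ := Γ) (Δ := A :: Θ) p s))))
  | tensorR_right₁ {Γ Δ Θ : List (Formula α)} {X A B : Formula α} (p : Prf Γ X) (q : Prf (X :: Δ) A) (s : Prf Θ B) :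
      Step (cut p (tensorR q s)) ((tensorR (cut p q) s).cast (List.append_assoc Γ Δ Θ))
  | tensorR_right₂ {Γ Δ Θ : List (Formula α)} {X A B : Formula α} (p : Prf Γ X) (q : Prf Δ A) (s : Prf (X :: Θ) B) :
      Step (cut (Δ := Δ ++ Θ) p (exch (Exch.blocks Δ [X] Θ) (tensorR q s)))
        (exch (Exch.blocks Δ Γ Θ) (tensorR q (cut p s)))
  | tensorL_right {Γ Δ : List (Formula α)} {X A B C : Formula α} (p : Prf Γ X) (q : Prf (A :: B :: X :: Δ) C) :
      Step (cut p (exch (Exch.swap (Formula.tensor A B) X Δ) (tensorL q)))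
        (exch (Exch.blocks [Formula.tensor A B] Γ Δ)
          (tensorL (exch (Exch.blocks Γ [A, B] Δ) (cut (Γ := Γ) (Δ := A :: B :: Δ) p (exch (Exch.blocks [A, B] [X] Δ) q)))))
  | lolliR_right {Γ Δ : List (Formula α)} {X A B : Formula α} (p : Prf Γ X) (q : Prf (A :: X :: Δ) B) :
      Step (cut p (lolliR q))
        (lolliR (exch (Exch.blocks Γ [A] Δ) (cut (Γ := Γ) (Δ := A :: Δ) p (exch (Exch.swap A X Δ) q))))
  | lolliL_right₁ {Γ Δ Θ : List (Formula α)} {X A B C : Formula α} (p : Prf Γ X) (q : Prf (X :: Δ) A) (s : Prf (B :: Θ) C) :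
      Step (cut p (exch (Exch.swap (Formula.lolli A B) X (Δ ++ Θ)) (lolliL q s)))
        (exch (Exch.blocks [Formula.lolli A B] Γ (Δ ++ Θ))
          ((lolliL (cut p q) s).cast
            (congrArg (List.cons (Formula.lolli A B)) (List.append_assoc Γ Δ Θ))))
  | lolliL_right₂ {Γ Δ Θ : List (Formula α)} {X A B C : Formula α} (p : Prf Γ X) (q : Prf Δ A) (s : Prf (B :: X :: Θ) C) :
      Step (cut (Δ := Formula.lolli A B :: (Δ ++ Θ)) p
        (exch (Exch.blocks (Formula.lolli A B :: Δ) [X] Θ) (lolliL q s)))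
        (exch (Exch.blocks (Formula.lolli A B :: Δ) Γ Θ)
          (lolliL q (exch (Exch.blocks Γ [B] Θ) (cut (Γ := Γ) (Δ := B :: Θ) p (exch (Exch.swap B X Θ) s)))))
  | ampR_right {Γ Δ : List (Formula α)} {X A B : Formula α} (p : Prf Γ X) (q : Prf (X :: Δ) A) (s : Prf (X :: Δ) B) :
      Step (cut p (ampR q s)) (ampR (cut p q) (cut p s))
  | ampL0_right {Γ Δ : List (Formula α)} {X A C : Formula α} (B : Formula α) (p : Prf Γ X) (q : Prf (A :: X :: Δ) C) :
      Step (cut p (exch (Exch.swap (amp A B) X Δ) (ampL0 B q)))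
        (exch (Exch.blocks [amp A B] Γ Δ)
          (ampL0 B (exch (Exch.blocks Γ [A] Δ) (cut (Γ := Γ) (Δ := A :: Δ) p (exch (Exch.swap A X Δ) q)))))
  | ampL1_right {Γ Δ : List (Formula α)} {X B C : Formula α} (A : Formula α) (p : Prf Γ X) (q : Prf (B :: X :: Δ) C) :
      Step (cut p (exch (Exch.swap (amp A B) X Δ) (ampL1 A q)))
        (exch (Exch.blocks [amp A B] Γ Δ)
          (ampL1 A (exch (Exch.blocks Γ [B] Δ) (cut (Γ := Γ) (Δ := B :: Δ) p (exch (Exch.swap B X Δ) q)))))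
  | der_right {Γ Δ : List (Formula α)} {X A C : Formula α} (p : Prf Γ X) (q : Prf (A :: X :: Δ) C) :
      Step (cut p (exch (Exch.swap (bang A) X Δ) (der q)))
        (exch (Exch.blocks [bang A] Γ Δ)
          (der (exch (Exch.blocks Γ [A] Δ) (cut (Γ := Γ) (Δ := A :: Δ) p (exch (Exch.swap A X Δ) q)))))
  | ctr_right {Γ Δ : List (Formula α)} {X A C : Formula α} (p : Prf Γ X) (q : Prf (bang A :: bang A :: X :: Δ) C) :
      Step (cut p (exch (Exch.swap (bang A) X Δ) (ctr q)))
        (exch (Exch.blocks [bang A] Γ Δ)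
          (ctr (exch (Exch.blocks Γ [bang A, bang A] Δ)
            (cut (Γ := Γ) (Δ := bang A :: bang A :: Δ) p (exch (Exch.blocks [bang A, bang A] [X] Δ) q)))))
  | wk_right {Γ Δ : List (Formula α)} {X C : Formula α} (A : Formula α) (p : Prf Γ X) (q : Prf (X :: Δ) C) :
      Step (cut p (exch (Exch.swap (bang A) X Δ) (wk A q)))
        (exch (Exch.blocks [bang A] Γ Δ) (wk A (cut (Γ := Γ) (Δ := Δ) p q)))
  -- expansion of axioms
  | eta_tensor (A B : Formula α) : Step (ax (Formula.tensor A B)) (tensorL (tensorR (ax A) (ax B)))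
  | eta_lolli (A B : Formula α) : Step (ax (Formula.lolli A B))
      (lolliR (exch (Exch.swap (Formula.lolli A B) A []) (lolliL (ax A) (ax B))))
  | eta_amp (A B : Formula α) : Step (ax (amp A B)) (ampR (ampL0 B (ax A)) (ampL1 A (ax B)))
  | eta_bang (A : Formula α) : Step (ax (bang A)) (prom (Γ := [A]) (der (ax A)))

/-- Equivalence of proofs under cut-elimination: the congruence generated by the elementary
transformations. -/
inductive CutEquiv : ∀ {Γ : List (Formula α)} {A : Formula α}, Prf Γ A → Prf Γ A → Prop
  | step {Γ : List (Formula α)} {A : Formula α} {p q : Prf Γ A} (h : Step p q) : CutEquiv p q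
  | refl {Γ : List (Formula α)} {A : Formula α} (p : Prf Γ A) : CutEquiv p p
  | symm {Γ : List (Formula α)} {A : Formula α} {p q : Prf Γ A} (h : CutEquiv p q) : CutEquiv q p
  | trans {Γ : List (Formula α)} {A : Formula α} {p q s : Prf Γ A} (h : CutEquiv p q) (h' : CutEquiv q s) : CutEquiv p s
  | exch {Γ Δ : List (Formula α)} {A : Formula α} (e : Exch Γ Δ) {p p' : Prf Γ A} (h : CutEquiv p p') : CutEquiv (exch e p) (exch e p')
  | cut {Γ Δ : List (Formula α)} {A B : Formula α} {p p' : Prf Γ A} {q q' : Prf (A :: Δ) B} (h : CutEquiv p p') (h' : CutEquiv q q') :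
      CutEquiv (cut p q) (cut p' q')
  | tensorR {Γ Δ : List (Formula α)} {A B : Formula α} {p p' : Prf Γ A} {q q' : Prf Δ B} (h : CutEquiv p p') (h' : CutEquiv q q') :
      CutEquiv (tensorR p q) (tensorR p' q')
  | tensorL {Γ : List (Formula α)} {A B C : Formula α} {p p' : Prf (A :: B :: Γ) C} (h : CutEquiv p p') :
      CutEquiv (tensorL p) (tensorL p')
  | lolliR {Γ : List (Formula α)} {A B : Formula α} {p p' : Prf (A :: Γ) B} (h : CutEquiv p p') : CutEquiv (lolliR p) (lolliR p')
  | lolliL {Γ Δ : List (Formula α)} {A B C : Formula α} {p p' : Prf Γ A} {q q' : Prf (B :: Δ) C} (h : CutEquiv p p')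
      (h' : CutEquiv q q') : CutEquiv (lolliL p q) (lolliL p' q')
  | ampR {Γ : List (Formula α)} {A B : Formula α} {p p' : Prf Γ A} {q q' : Prf Γ B} (h : CutEquiv p p') (h' : CutEquiv q q') :
      CutEquiv (ampR p q) (ampR p' q')
  | ampL0 {Γ : List (Formula α)} {A C : Formula α} (B : Formula α) {p p' : Prf (A :: Γ) C} (h : CutEquiv p p') : CutEquiv (ampL0 B p) (ampL0 B p')
  | ampL1 {Γ : List (Formula α)} {B C : Formula α} (A : Formula α) {p p' : Prf (B :: Γ) C} (h : CutEquiv p p') : CutEquiv (ampL1 A p) (ampL1 A p')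
  | prom {Γ : List (Formula α)} {A : Formula α} {p p' : Prf (Γ.map bang) A} (h : CutEquiv p p') : CutEquiv (prom p) (prom p')
  | der {Γ : List (Formula α)} {A B : Formula α} {p p' : Prf (A :: Γ) B} (h : CutEquiv p p') : CutEquiv (der p) (der p')
  | ctr {Γ : List (Formula α)} {A B : Formula α} {p p' : Prf (bang A :: bang A :: Γ) B} (h : CutEquiv p p') : CutEquiv (ctr p) (ctr p')
  | wk {Γ : List (Formula α)} {B : Formula α} (A : Formula α) {p p' : Prf Γ B} (h : CutEquiv p p') : CutEquiv (wk A p) (wk A p')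

instance setoid (Γ : List (Formula α)) (A : Formula α) : Setoid (Prf Γ A) where
  r := CutEquiv
  iseqv := ⟨CutEquiv.refl, CutEquiv.symm, CutEquiv.trans⟩

end Prf

/-- Proofs of `Γ ⊢ A` modulo equivalence under cut-elimination. -/
abbrev ProofClass (Γ : List (Formula α)) (A : Formula α) : Type v := Quotient (Prf.setoid Γ A)

namespace ProofClass

def cut {Γ Δ : List (Formula α)} {A B : Formula α} (p : ProofClass Γ A)
    (q : ProofClass (A :: Δ) B) : ProofClass (Γ ++ Δ) B :=
  Quotient.map₂ Prf.cut (fun _ _ h _ _ h' => Prf.CutEquiv.cut h h') p q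

/-- `π(X)`: the result of cutting a proof `π`, whose hypotheses are the formulas `A s` with `s` in a
list of labels, against closed proofs `X s` of the formulas `A s`. -/
def plug {σ : Type} {A : σ → Formula α} {B : Formula α} (X : ∀ s, ProofClass [] (A s)) :
    ∀ ls : List σ, ProofClass (ls.map A) B → ProofClass [] B
  | [], π => π
  | s :: ls, π => plug X ls (cut (X s) π)

end ProofClass

section Plain

variable {r : ℕ} (n : Fin r → ℕ)

/-- The index set `{(i, j) | 1 ≤ i ≤ r, 1 ≤ j ≤ n i}` of the hypotheses `n₁ A₁, …, n_r A_r`. -/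
abbrev Slot : Type := Σ i : Fin r, Fin (n i)

/-- The indices `(i, j)` in lexicographic order. -/
def slots : List (Slot n) :=
  (List.finRange r).flatMap fun i => (List.finRange (n i)).map fun j => ⟨i, j⟩

variable {n} (A : Fin r → Formula α)

/-- A hypothesis is either one of the copies of `A i`, or a copy of `!(A i)`. -/
def hyp : Slot n ⊕ Fin r → Formula α
  | Sum.inl s => A s.1
  | Sum.inr i => bang (A i)

/-- The proofs obtained from a proof `π` of `n₁ A₁, …, n_r A_r ⊢ B` by derelictions of the copies of
the `A i`, contractions of two copies of the same hypothesis `!(A i)`, weakenings introducing an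
`!(A i)` of which there is no copy, and exchanges. -/
inductive PlainDerivation {B : Formula α} (π : Prf ((slots n).map fun s => A s.1) B) :
    ∀ ls : List (Slot n ⊕ Fin r), Prf (ls.map (hyp A)) B → Prop
  | base : PlainDerivation π ((slots n).map Sum.inl) (π.cast (List.map_map (f := Sum.inl) (g := hyp A)).symm)
  | exch {ls ls'} (e : Exch ls ls') {p} (h : PlainDerivation π ls p) :
      PlainDerivation π ls' (Prf.exch (e.map (hyp A)) p)
  | der {ls} (s : Slot n) {p} (h : PlainDerivation π (Sum.inl s :: ls) p) :
      PlainDerivation π (Sum.inr s.1 :: ls) (Prf.der p)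
  | ctr {ls} (i : Fin r) {p} (h : PlainDerivation π (Sum.inr i :: Sum.inr i :: ls) p) :
      PlainDerivation π (Sum.inr i :: ls) (Prf.ctr p)
  | wk {ls} (i : Fin r) (hn : n i = 0) (hi : Sum.inr i ∉ ls) {p} (h : PlainDerivation π ls p) :
      PlainDerivation π (Sum.inr i :: ls) (Prf.wk (A i) p)

/-- `ψ : !A₁, …, !A_r ⊢ B` is plain, constructed from `π` with degree vector `n`. -/
def IsPlainFrom {B : Formula α} (π : Prf ((slots n).map fun s => A s.1) B)
    (ψ : Prf ((List.finRange r).map fun i => bang (A i)) B) : Prop :=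
  ∃ ψ₀ : Prf (((List.finRange r).map Sum.inr).map (hyp (n := n) A)) B,
    PlainDerivation A π ((List.finRange r).map Sum.inr) ψ₀ ∧ ψ ≈ ψ₀.cast (List.map_map (f := Sum.inr) (g := hyp A))

end Plain

end Calculus

section Semantics

open Formula

variable {k : Type u} [Field k] {α : Type v} (V : α → ModuleCat.{u} k)

/-- Denotations of formulas, given the denotations `V` of the atoms. -/
noncomputable def Formula.den : Formula α → ModuleCat.{u} k
  | atom a => V a
  | tensor A B => ModuleCat.of k (A.den ⊗[k] B.den)
  | amp A B => ModuleCat.of k (A.den × B.den)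
  | lolli A B => ModuleCat.of k (A.den →ₗ[k] B.den)
  | bang A => ModuleCat.of k (Bang k A.den)

/-- The denotation of a context is the tensor product of the denotations of its members. -/
noncomputable def denCtx : List (Formula α) → ModuleCat.{u} k
  | [] => ModuleCat.of k k
  | A :: Γ => ModuleCat.of k (A.den V ⊗[k] denCtx Γ)

/-- The vector `⨂ v s`, with `s` in a list of labels. -/
noncomputable def ctxVec {σ : Type} (A : σ → Formula α) (v : ∀ s, (A s).den V) :
    ∀ ls : List σ, denCtx V (ls.map A)
  | [] => (1 : k)
  | s :: ls => v s ⊗ₜ[k] ctxVec A v ls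

noncomputable def Exch.den : ∀ {Γ Δ : List (Formula α)}, Exch Γ Δ → (denCtx V Γ ≃ₗ[k] denCtx V Δ)
  | _, _, nil => LinearEquiv.refl k k
  | _, _, cons A e => TensorProduct.congr (LinearEquiv.refl k (A.den V)) e.den
  | _, _, swap A B Γ => TensorProduct.leftComm k (A.den V) (B.den V) (denCtx V Γ)
  | _, _, trans e e' => e.den.trans e'.den

noncomputable def denAppend : ∀ Γ Δ : List (Formula α),
    denCtx V (Γ ++ Δ) ≃ₗ[k] (denCtx V Γ ⊗[k] denCtx V Δ)
  | [], Δ => (TensorProduct.lid k (denCtx V Δ)).symm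
  | A :: Γ, Δ => (TensorProduct.congr (LinearEquiv.refl k (A.den V)) (denAppend Γ Δ)).trans
      (TensorProduct.assoc k (A.den V) (denCtx V Γ) (denCtx V Δ)).symm

/-- The denotation of `!Γ` is a coalgebra, as a tensor product of coalgebras. -/
noncomputable instance bangCtxCoalgebra :
    ∀ Γ : List (Formula α), Coalgebra k (denCtx V (Γ.map bang))
  | [] => inferInstanceAs (Coalgebra k k)
  | A :: Γ =>
    letI := bangCtxCoalgebra Γ
    inferInstanceAs (Coalgebra k (Bang k (A.den V) ⊗[k] denCtx V (Γ.map bang)))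

instance bangCtxIsCocomm :
    ∀ Γ : List (Formula α), Coalgebra.IsCocomm k (denCtx V (Γ.map bang))
  | [] => inferInstanceAs (Coalgebra.IsCocomm k k)
  | A :: Γ =>
    letI := bangCtxIsCocomm Γ
    inferInstanceAs (Coalgebra.IsCocomm k (Bang k (A.den V) ⊗[k] denCtx V (Γ.map bang)))

/-- The Sweedler semantics of proofs. -/
noncomputable def Prf.den : ∀ {Γ : List (Formula α)} {A : Formula α}, Prf Γ A →
    (denCtx V Γ →ₗ[k] A.den V)
  | _, _, ax A => (TensorProduct.rid k (A.den V)).toLinearMap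
  | _, _, exch e p => p.den ∘ₗ (e.den V).symm.toLinearMap
  | _, _, cut (Γ := Γ) (Δ := Δ) p q =>
      q.den ∘ₗ LinearMap.rTensor (denCtx V Δ) p.den ∘ₗ (denAppend V Γ Δ).toLinearMap
  | _, _, tensorR (Γ := Γ) (Δ := Δ) p q =>
      TensorProduct.map p.den q.den ∘ₗ (denAppend V Γ Δ).toLinearMap
  | _, _, tensorL (Γ := Γ) (A := A) (B := B) p =>
      p.den ∘ₗ (TensorProduct.assoc k (A.den V) (B.den V) (denCtx V Γ)).toLinearMap
  | _, _, lolliR (Γ := Γ) (A := A) (B := B) p =>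
      (TensorProduct.curry (p.den : A.den V ⊗[k] denCtx V Γ →ₗ[k] B.den V)).flip
  | _, _, lolliL (Γ := Γ) (Δ := Δ) (A := A) (B := B) p q =>
      q.den ∘ₗ
      LinearMap.rTensor (denCtx V Δ)
        (TensorProduct.lift (LinearMap.id (R := k) (M := A.den V →ₗ[k] B.den V)) ∘ₗ
          LinearMap.lTensor (A.den V →ₗ[k] B.den V) p.den) ∘ₗ
      (TensorProduct.assoc k (A.den V →ₗ[k] B.den V) (denCtx V Γ) (denCtx V Δ)).symm.toLinearMap ∘ₗ
      LinearMap.lTensor (A.den V →ₗ[k] B.den V) (denAppend V Γ Δ).toLinearMap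
  | _, _, ampR p q => p.den.prod q.den
  | _, _, ampL0 (Γ := Γ) (A := A) B p =>
      p.den ∘ₗ LinearMap.rTensor (denCtx V Γ) (LinearMap.fst k (A.den V) (B.den V))
  | _, _, ampL1 (Γ := Γ) (B := B) A p =>
      p.den ∘ₗ LinearMap.rTensor (denCtx V Γ) (LinearMap.snd k (A.den V) (B.den V))
  | _, _, prom p => Bang.lift p.den
  | _, _, der (Γ := Γ) (A := A) p =>
      p.den ∘ₗ LinearMap.rTensor (denCtx V Γ) (Bang.d k (A.den V))
  | _, _, ctr (Γ := Γ) (A := A) p =>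
      p.den ∘ₗ
      (TensorProduct.assoc k (Bang k (A.den V)) (Bang k (A.den V)) (denCtx V Γ)).toLinearMap ∘ₗ
      LinearMap.rTensor (denCtx V Γ) (Coalgebra.comul (R := k) (A := Bang k (A.den V)))
  | _, _, wk (Γ := Γ) A p =>
      p.den ∘ₗ (TensorProduct.lid k (denCtx V Γ)).toLinearMap ∘ₗ
      LinearMap.rTensor (denCtx V Γ) (Coalgebra.counit (R := k) (A := Bang k (A.den V)))


/-! Invariance of denotations under cut-elimination. -/

section Invariance

variable {V}

/-- `a ⊗ x` -/
noncomputable def ct {A : Formula α} {Γ : List (Formula α)} :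
    A.den V →ₗ[k] denCtx V Γ →ₗ[k] denCtx V (A :: Γ) := TensorProduct.mk k (A.den V) (denCtx V Γ)

/-- `x ⊗ y` for vectors in the denotations of contexts -/
noncomputable def app {Γ Δ : List (Formula α)} :
    denCtx V Γ →ₗ[k] denCtx V Δ →ₗ[k] denCtx V (Γ ++ Δ) :=
  (TensorProduct.mk k (denCtx V Γ) (denCtx V Δ)).compr₂ (denAppend V Γ Δ).symm.toLinearMap

noncomputable def tt {A B : Formula α} : A.den V →ₗ[k] B.den V →ₗ[k] (tensor A B).den V :=
  TensorProduct.mk k (A.den V) (B.den V)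

variable (V) in
/-- The vector `1` in the denotation of the empty context. -/
noncomputable def nilVec : denCtx V [] := (1 : k)

theorem app_nil {Δ : List (Formula α)} (y : denCtx V Δ) :
    app (Γ := []) (nilVec V) y = y := (TensorProduct.lid_tmul y (1 : k)).trans (one_smul _ _)

theorem app_ct {A : Formula α} {Γ Δ : List (Formula α)} (a : A.den V) (x : denCtx V Γ)
    (y : denCtx V Δ) : app (Γ := A :: Γ) (ct a x) y = ct a (app x y) := rfl

section ext

variable {M : Type*} [AddCommGroup M] [Module k M]

theorem nil_ext {f g : denCtx V [] →ₗ[k] M} (h : f (nilVec V) = g (nilVec V)) : f = g :=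
  LinearMap.ext_ring h

theorem ct_ext {A : Formula α} {Γ : List (Formula α)}
    {f g : denCtx V (A :: Γ) →ₗ[k] M} (h : ∀ a x, f (ct a x) = g (ct a x)) : f = g :=
  TensorProduct.ext' h

theorem app_ext {Γ Δ : List (Formula α)}
    {f g : denCtx V (Γ ++ Δ) →ₗ[k] M} (h : ∀ x y, f (app x y) = g (app x y)) : f = g := by
  have : f ∘ₗ (denAppend V Γ Δ).symm.toLinearMap = g ∘ₗ (denAppend V Γ Δ).symm.toLinearMap :=
    TensorProduct.ext' h
  ext x
  have h2 := LinearMap.congr_fun this (denAppend V Γ Δ x)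
  simpa using h2

theorem app₃_ext {Γ Δ Θ : List (Formula α)} {f g : denCtx V (Γ ++ (Δ ++ Θ)) →ₗ[k] M}
    (h : ∀ x y z, f (app x (app y z)) = g (app x (app y z))) : f = g := by
  apply app_ext
  intro x y
  have : f ∘ₗ app x = g ∘ₗ app x := app_ext (h x)
  exact LinearMap.congr_fun this y

theorem app₃_ext' {Γ Δ Θ : List (Formula α)} {f g : denCtx V ((Γ ++ Δ) ++ Θ) →ₗ[k] M}
    (h : ∀ x y z, f (app (app x y) z) = g (app (app x y) z)) : f = g := by
  apply app_ext
  intro x y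
  have : f ∘ₗ app.flip y = g ∘ₗ app.flip y := app_ext (fun x z => h x z y)
  exact LinearMap.congr_fun this x

theorem app_ct_ext {A : Formula α} {Γ Δ : List (Formula α)} {f g : denCtx V (Γ ++ A :: Δ) →ₗ[k] M}
    (h : ∀ x a y, f (app x (ct a y)) = g (app x (ct a y))) : f = g := by
  apply app_ext
  intro x y
  have : f ∘ₗ app x = g ∘ₗ app x := ct_ext (h x)
  exact LinearMap.congr_fun this y

theorem ct_app_ext {A : Formula α} {Γ Δ : List (Formula α)} {f g : denCtx V (A :: (Γ ++ Δ)) →ₗ[k] M}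
    (h : ∀ a x y, f (ct a (app x y)) = g (ct a (app x y))) : f = g := by
  apply ct_ext
  intro a y
  have : f ∘ₗ ct a = g ∘ₗ ct a := app_ext (h a)
  exact LinearMap.congr_fun this y

theorem tt_ext {A B : Formula α} {f g : (tensor A B).den V →ₗ[k] M}
    (h : ∀ a b, f (tt a b) = g (tt a b)) : f = g :=
  TensorProduct.ext' h

end ext

noncomputable def castE {Γ Δ : List (Formula α)} (h : Γ = Δ) : denCtx V Γ ≃ₗ[k] denCtx V Δ :=
  h ▸ LinearEquiv.refl k _

theorem den_cast {Γ Δ : List (Formula α)} {A : Formula α} (h : Γ = Δ) (p : Prf Γ A)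
    (x : denCtx V Δ) : (p.cast h).den V x = p.den V (castE h.symm x) := by
  subst h; rfl

theorem castE_ct {Γ Δ : List (Formula α)} {A : Formula α} (h : A :: Γ = A :: Δ) (a : A.den V)
    (x : denCtx V Γ) : castE h (ct a x) = ct a (castE (List.cons.inj h).2 x) := by
  obtain rfl := (List.cons.inj h).2; rfl

theorem castE_symm_apply {Γ Δ : List (Formula α)} (h : Γ = Δ) (x : denCtx V Γ) (y : denCtx V Δ)
    (e : castE h x = y) : castE h.symm y = x := by
  subst h; exact e.symm

theorem castE_assoc {Γ Δ Θ : List (Formula α)} (h : (Γ ++ Δ) ++ Θ = Γ ++ (Δ ++ Θ))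
    (x : denCtx V Γ) (y : denCtx V Δ) (z : denCtx V Θ) :
    castE h (app (app x y) z) = app x (app y z) := by
  induction Γ with
  | nil =>
    have : (castE (V := V) h).toLinearMap ∘ₗ app.flip z ∘ₗ (app (Γ := []) (Δ := Δ)).flip y =
        (app (Γ := []) (Δ := Δ ++ Θ)).flip (app y z) := by
      apply nil_ext
      simp only [LinearMap.comp_apply, LinearMap.flip_apply, app_nil]
      exact rfl
    exact LinearMap.congr_fun this x
  | cons A Γ ih =>
    have : (castE (V := V) h).toLinearMap ∘ₗ app.flip z ∘ₗ (app (Γ := A :: Γ) (Δ := Δ)).flip y =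
        (app (Γ := A :: Γ) (Δ := Δ ++ Θ)).flip (app y z) := by
      apply ct_ext
      intro a x
      simp only [LinearMap.comp_apply, LinearMap.flip_apply, app_ct]
      exact (castE_ct h a _).trans (congrArg (ct a) (ih _ x))
    exact LinearMap.congr_fun this x

theorem castE_assoc_symm {Γ Δ Θ : List (Formula α)} (h : Γ ++ (Δ ++ Θ) = (Γ ++ Δ) ++ Θ)
    (x : denCtx V Γ) (y : denCtx V Δ) (z : denCtx V Θ) :
    castE h (app x (app y z)) = app (app x y) z :=
  castE_symm_apply h.symm _ _ (castE_assoc h.symm x y z)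

theorem castE_append_nil {Γ : List (Formula α)} (h : Γ ++ [] = Γ) (x : denCtx V Γ) :
    castE h (app x (nilVec V)) = x := by
  induction Γ with
  | nil =>
    have : (app (Γ := []) (Δ := [])).flip (nilVec V) = LinearMap.id := nil_ext (app_nil _)
    exact LinearMap.congr_fun this x
  | cons A Γ ih =>
    have : (castE (V := V) h).toLinearMap ∘ₗ (app (Γ := A :: Γ)).flip (nilVec V) =
        LinearMap.id := by
      apply ct_ext
      intro a x
      simp only [LinearMap.comp_apply, LinearMap.flip_apply, app_ct]
      exact (castE_ct h a _).trans (congrArg (ct a) (ih _ x))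
    exact LinearMap.congr_fun this x

/-! Exchanges. -/

theorem refl_den (Γ : List (Formula α)) (x : denCtx V Γ) : (Exch.refl Γ).den V x = x := by
  induction Γ with
  | nil => rfl
  | cons A Γ ih =>
    have : ((Exch.refl (A :: Γ)).den V).toLinearMap = LinearMap.id := by
      apply ct_ext
      intro a x
      exact congrArg (ct a) (ih x)
    exact LinearMap.congr_fun this x

theorem cons_den {Γ Δ : List (Formula α)} (e : Exch Γ Δ) {A : Formula α} (a : A.den V)
    (x : denCtx V Γ) : (e.cons A).den V (ct a x) = ct a (e.den V x) := rfl

theorem swap_den {Γ : List (Formula α)} {A B : Formula α} (a : A.den V) (b : B.den V)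
    (x : denCtx V Γ) : (Exch.swap A B Γ).den V (ct a (ct b x)) = ct b (ct a x) := rfl

theorem trans_den {Γ Δ Θ : List (Formula α)} (e : Exch Γ Δ) (e' : Exch Δ Θ) (x : denCtx V Γ) :
    (e.trans e').den V x = e'.den V (e.den V x) := rfl

theorem appendRight_den {Γ Δ : List (Formula α)} (e : Exch Γ Δ) (Θ : List (Formula α))
    (x : denCtx V Γ) (y : denCtx V Θ) :
    (e.appendRight Θ).den V (app x y) = app (e.den V x) y := by
  induction e with
  | nil => exact refl_den _ _
  | cons A e ih =>
    have : ((Exch.appendRight (Exch.cons A e) Θ).den V).toLinearMap ∘ₗ app.flip y =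
        app.flip y ∘ₗ ((Exch.cons A e).den V).toLinearMap := by
      apply ct_ext
      intro a x
      exact congrArg (ct a) (ih x)
    exact LinearMap.congr_fun this x
  | swap A B Γ =>
    have : ((Exch.appendRight (Exch.swap A B Γ) Θ).den V).toLinearMap ∘ₗ app.flip y =
        app.flip y ∘ₗ ((Exch.swap A B Γ).den V).toLinearMap := by
      apply ct_ext
      intro a x
      have : (((Exch.appendRight (Exch.swap A B Γ) Θ).den V).toLinearMap ∘ₗ app.flip y) ∘ₗ ct a =
        (app.flip y ∘ₗ ((Exch.swap A B Γ).den V).toLinearMap) ∘ₗ ct a := by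
        apply ct_ext
        intro b x
        rfl
      exact LinearMap.congr_fun this x
    exact LinearMap.congr_fun this x
  | trans e e' ih ih' =>
    change (e'.appendRight Θ).den V ((e.appendRight Θ).den V (app x y)) = _
    rw [ih, ih']; rfl

theorem appendLeft_den (Γ : List (Formula α)) {Δ Θ : List (Formula α)} (e : Exch Δ Θ)
    (x : denCtx V Γ) (y : denCtx V Δ) :
    (Exch.appendLeft Γ e).den V (app x y) = app x (e.den V y) := by
  induction Γ with
  | nil =>
    have : ((Exch.appendLeft [] e).den V).toLinearMap ∘ₗ (app (Γ := [])).flip y =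
        (app (Γ := [])).flip (e.den V y) := by
      apply nil_ext
      simp only [LinearMap.comp_apply, LinearMap.flip_apply, app_nil]
      exact rfl
    exact LinearMap.congr_fun this x
  | cons A Γ ih =>
    have : ((Exch.appendLeft (A :: Γ) e).den V).toLinearMap ∘ₗ app.flip y =
        app.flip (e.den V y) := by
      apply ct_ext
      intro a x
      exact congrArg (ct a) (ih x)
    exact LinearMap.congr_fun this x

theorem append_den {Γ Γ' Δ Δ' : List (Formula α)} (e : Exch Γ Γ') (e' : Exch Δ Δ')
    (x : denCtx V Γ) (y : denCtx V Δ) :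
    (e.append e').den V (app x y) = app (e.den V x) (e'.den V y) := by
  rw [Exch.append, trans_den, appendRight_den, appendLeft_den]

theorem bubble_den (A : Formula α) (Γ Δ : List (Formula α)) (a : A.den V) (x : denCtx V Γ)
    (y : denCtx V Δ) : (Exch.bubble A Γ Δ).den V (ct a (app x y)) = app x (ct a y) := by
  induction Γ with
  | nil =>
    have : ((Exch.bubble A [] Δ).den V).toLinearMap ∘ₗ ct a ∘ₗ (app (Γ := [])).flip y =
        (app (Γ := [])).flip (ct a y) := by
      apply nil_ext
      simp only [LinearMap.comp_apply, LinearMap.flip_apply, app_nil]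
      exact refl_den _ _
    exact LinearMap.congr_fun this x
  | cons B Γ ih =>
    have : ((Exch.bubble A (B :: Γ) Δ).den V).toLinearMap ∘ₗ ct a ∘ₗ app.flip y =
        app.flip (ct a y) := by
      apply ct_ext
      intro b x
      exact congrArg (ct b) (ih x)
    exact LinearMap.congr_fun this x

theorem blocks_den (Γ Δ Θ : List (Formula α)) (x : denCtx V Γ) (y : denCtx V Δ)
    (z : denCtx V Θ) : (Exch.blocks Γ Δ Θ).den V (app x (app y z)) = app y (app x z) := by
  induction Γ with
  | nil =>
    have : ((Exch.blocks [] Δ Θ).den V).toLinearMap ∘ₗ (app (Γ := [])).flip (app y z) =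
        app y ∘ₗ (app (Γ := [])).flip z := by
      apply nil_ext
      simp only [LinearMap.comp_apply, LinearMap.flip_apply, app_nil]
      exact refl_den _ _
    exact LinearMap.congr_fun this x
  | cons A Γ ih =>
    have : ((Exch.blocks (A :: Γ) Δ Θ).den V).toLinearMap ∘ₗ app.flip (app y z) =
        app y ∘ₗ app.flip z := by
      apply ct_ext
      intro a x
      change (Exch.bubble A Δ (Γ ++ Θ)).den V (ct a ((Exch.blocks Γ Δ Θ).den V (app x (app y z)))) =
        app y (ct a (app x z))
      rw [ih, bubble_den]
    exact LinearMap.congr_fun this x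

/-! Values of the denotations of proofs. -/

theorem den_ax (A : Formula α) (a : A.den V) : (Prf.ax A).den V (ct a (nilVec V)) = a :=
  (TensorProduct.rid_tmul a (1 : k)).trans (one_smul _ _)

theorem den_exch {Γ Δ : List (Formula α)} {A : Formula α} (e : Exch Γ Δ) (p : Prf Γ A)
    {x : denCtx V Δ} (y : denCtx V Γ) (h : e.den V y = x) :
    (Prf.exch e p).den V x = p.den V y := by
  subst h
  exact congrArg (p.den V) ((e.den V).symm_apply_apply y)

theorem den_cut {Γ Δ : List (Formula α)} {A B : Formula α} (p : Prf Γ A) (q : Prf (A :: Δ) B)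
    (x : denCtx V Γ) (y : denCtx V Δ) :
    (Prf.cut p q).den V (app x y) = q.den V (ct (p.den V x) y) := by
  change q.den V (LinearMap.rTensor (denCtx V Δ) (p.den V) (denAppend V Γ Δ
    ((denAppend V Γ Δ).symm (x ⊗ₜ[k] y)))) = _
  rw [LinearEquiv.apply_symm_apply]; rfl

theorem den_tensorR {Γ Δ : List (Formula α)} {A B : Formula α} (p : Prf Γ A) (q : Prf Δ B)
    (x : denCtx V Γ) (y : denCtx V Δ) :
    (Prf.tensorR p q).den V (app x y) = tt (p.den V x) (q.den V y) := by
  change TensorProduct.map (p.den V) (q.den V) (denAppend V Γ Δ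
    ((denAppend V Γ Δ).symm (x ⊗ₜ[k] y))) = _
  rw [LinearEquiv.apply_symm_apply]; rfl

theorem den_tensorL {Γ : List (Formula α)} {A B C : Formula α} (p : Prf (A :: B :: Γ) C)
    (a : A.den V) (b : B.den V) (x : denCtx V Γ) :
    (Prf.tensorL p).den V (ct (tt a b) x) = p.den V (ct a (ct b x)) := rfl

/-- Evaluation of the elements of `⟦A ⊸ B⟧`. -/
noncomputable def ev {A B : Formula α} : (lolli A B).den V →ₗ[k] A.den V →ₗ[k] B.den V :=
  LinearMap.id (M := A.den V →ₗ[k] B.den V)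

theorem ev_ext {A B : Formula α} {f g : (lolli A B).den V} (h : ∀ a, ev f a = ev g a) : f = g :=
  LinearMap.ext h

theorem den_lolliR {Γ : List (Formula α)} {A B : Formula α} (p : Prf (A :: Γ) B)
    (x : denCtx V Γ) (a : A.den V) : ev ((Prf.lolliR p).den V x) a = p.den V (ct a x) := rfl

theorem den_lolliL {Γ Δ : List (Formula α)} {A B C : Formula α} (p : Prf Γ A)
    (q : Prf (B :: Δ) C) (f : (lolli A B).den V) (x : denCtx V Γ) (y : denCtx V Δ) :
    (Prf.lolliL p q).den V (ct f (app x y)) = q.den V (ct (ev f (p.den V x)) y) := by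
  change q.den V (LinearMap.rTensor (denCtx V Δ) (TensorProduct.lift
      (LinearMap.id (R := k) (M := A.den V →ₗ[k] B.den V)) ∘ₗ
          LinearMap.lTensor (A.den V →ₗ[k] B.den V) (p.den V))
      ((TensorProduct.assoc k (A.den V →ₗ[k] B.den V) (denCtx V Γ) (denCtx V Δ)).symm
        ((f : A.den V →ₗ[k] B.den V) ⊗ₜ[k] (denAppend V Γ Δ
    ((denAppend V Γ Δ).symm (x ⊗ₜ[k] y)))))) = _
  rw [LinearEquiv.apply_symm_apply]; rfl

noncomputable def pr₀ {A B : Formula α} : (amp A B).den V →ₗ[k] A.den V :=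
  LinearMap.fst k (A.den V) (B.den V)

noncomputable def pr₁ {A B : Formula α} : (amp A B).den V →ₗ[k] B.den V :=
  LinearMap.snd k (A.den V) (B.den V)

theorem pr_ext {A B : Formula α} {a b : (amp A B).den V} (h₀ : pr₀ a = pr₀ b)
    (h₁ : pr₁ a = pr₁ b) : a = b := Prod.ext h₀ h₁

theorem den_ampR₀ {Γ : List (Formula α)} {A B : Formula α} (p : Prf Γ A) (q : Prf Γ B)
    (x : denCtx V Γ) : pr₀ ((Prf.ampR p q).den V x) = p.den V x := rfl

theorem den_ampR₁ {Γ : List (Formula α)} {A B : Formula α} (p : Prf Γ A) (q : Prf Γ B)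
    (x : denCtx V Γ) : pr₁ ((Prf.ampR p q).den V x) = q.den V x := rfl

theorem den_ampL0 {Γ : List (Formula α)} {A C : Formula α} (B : Formula α) (p : Prf (A :: Γ) C)
    (a : (amp A B).den V) (x : denCtx V Γ) :
    (Prf.ampL0 B p).den V (ct a x) = p.den V (ct (pr₀ a) x) := rfl

theorem den_ampL1 {Γ : List (Formula α)} {B C : Formula α} (A : Formula α) (p : Prf (B :: Γ) C)
    (a : (amp A B).den V) (x : denCtx V Γ) :
    (Prf.ampL1 A p).den V (ct a x) = p.den V (ct (pr₁ a) x) := rfl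

noncomputable def dd {A : Formula α} : (bang A).den V →ₗ[k] A.den V := Bang.d k (A.den V)

noncomputable def eps {A : Formula α} : (bang A).den V →ₗ[k] k :=
  Coalgebra.counit (R := k) (A := Bang k (A.den V))

noncomputable def dup {A : Formula α} :
    (bang A).den V →ₗ[k] Bang k (A.den V) ⊗[k] Bang k (A.den V) :=
  Coalgebra.comul (R := k) (A := Bang k (A.den V))

/-- `(a ⊗ b) ⊗ x ↦ a ⊗ (b ⊗ x)` -/
noncomputable def ct₂ {A : Formula α} {Γ : List (Formula α)} :
    Bang k (A.den V) ⊗[k] Bang k (A.den V) →ₗ[k] denCtx V Γ →ₗ[k]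
      denCtx V (bang A :: bang A :: Γ) :=
  TensorProduct.curry
    (TensorProduct.assoc k (Bang k (A.den V)) (Bang k (A.den V)) (denCtx V Γ)).toLinearMap

/-- `a ⊗ b` -/
noncomputable def tw {A : Formula α} :
    (bang A).den V →ₗ[k] (bang A).den V →ₗ[k] Bang k (A.den V) ⊗[k] Bang k (A.den V) :=
  TensorProduct.mk k (Bang k (A.den V)) (Bang k (A.den V))

theorem ct₂_tw {A : Formula α} {Γ : List (Formula α)} (a b : (bang A).den V) (x : denCtx V Γ) :
    ct₂ (tw a b) x = ct a (ct b x) := rfl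

theorem den_der {Γ : List (Formula α)} {A B : Formula α} (p : Prf (A :: Γ) B)
    (a : (bang A).den V) (x : denCtx V Γ) :
    (Prf.der p).den V (ct a x) = p.den V (ct (dd a) x) := rfl

theorem den_ctr {Γ : List (Formula α)} {A B : Formula α} (p : Prf (bang A :: bang A :: Γ) B)
    (a : (bang A).den V) (x : denCtx V Γ) :
    (Prf.ctr p).den V (ct a x) = p.den V (ct₂ (dup a) x) := rfl

theorem den_wk {Γ : List (Formula α)} {B : Formula α} (A : Formula α) (p : Prf Γ B)
    (a : (bang A).den V) (x : denCtx V Γ) :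
    (Prf.wk A p).den V (ct a x) = eps a • p.den V x :=
  (congrArg (p.den V) (TensorProduct.lid_tmul x (eps a))).trans (map_smul _ _ _)

/-- To compare two linear functions of `dup a` it suffices to compare them on pure tensors. -/
theorem dup_ext {M : Type*} [AddCommGroup M] [Module k M] {A : Formula α}
    {f g : Bang k (A.den V) ⊗[k] Bang k (A.den V) →ₗ[k] M}
    (h : ∀ a b : (bang A).den V, f (tw a b) = g (tw a b)) (t) : f t = g t :=
  LinearMap.congr_fun
    (TensorProduct.ext' (M := Bang k (A.den V)) (N := Bang k (A.den V)) h) t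

theorem den_prom {Γ : List (Formula α)} {A : Formula α} (p : Prf (Γ.map bang) A)
    (x : denCtx V (Γ.map bang)) : (Prf.prom p).den V x = Bang.lift (p.den V) x := rfl

/-! Coherence of exchanges. -/

/-- The tensor product of a list of vectors. -/
noncomputable def pureVec : ∀ L : List (Σ A : Formula α, A.den V), denCtx V (L.map Sigma.fst)
  | [] => nilVec V
  | a :: L => ct a.2 (pureVec L)

theorem pureVec_ext {M : Type*} [AddCommGroup M] [Module k M] {Γ : List (Formula α)}
    {f g : denCtx V Γ →ₗ[k] M}
    (h : ∀ (L : List (Σ A : Formula α, A.den V)) (hL : L.map Sigma.fst = Γ),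
      f (castE hL (pureVec L)) = g (castE hL (pureVec L))) : f = g := by
  induction Γ with
  | nil => exact nil_ext (h [] rfl)
  | cons A Γ ih =>
    apply ct_ext
    intro a x
    have : f ∘ₗ ct a = g ∘ₗ ct a := by
      apply ih
      intro L hL
      have := h (⟨A, a⟩ :: L) (by simp [hL])
      subst hL
      exact this
    exact LinearMap.congr_fun this x

theorem exch_pure {Γ Δ : List (Formula α)} (e : Exch Γ Δ) :
    ∀ (L : List (Σ A : Formula α, A.den V)) (hL : L.map Sigma.fst = Γ),
      ∃ (L' : List (Σ A : Formula α, A.den V)) (hL' : L'.map Sigma.fst = Δ),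
        e.den V (castE hL (pureVec L)) = castE hL' (pureVec L') ∧ ∀ i, L[i]? = L'[e.pos i]? := by
  induction e with
  | nil =>
    intro L hL
    obtain rfl := List.map_eq_nil_iff.1 hL
    exact ⟨[], rfl, rfl, fun i => by simp⟩
  | cons A e ih =>
    intro L hL
    match L, hL with
    | ⟨B, b⟩ :: L, hL =>
      have h0 := List.cons.inj hL
      obtain rfl : B = A := h0.1
      obtain rfl := h0.2
      obtain ⟨L', hL', h1, h2⟩ := ih L rfl
      subst hL'
      refine ⟨⟨B, b⟩ :: L', rfl, congrArg (ct b) h1, fun i => ?_⟩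
      cases i with
      | zero => rfl
      | succ i => exact h2 i
  | swap A B Γ =>
    intro L hL
    match L, hL with
    | ⟨C, c⟩ :: ⟨D, d⟩ :: L, hL =>
      have h0 := List.cons.inj hL
      obtain rfl : C = A := h0.1
      have h0' := List.cons.inj h0.2
      obtain rfl : D = B := h0'.1
      obtain rfl := h0'.2
      refine ⟨⟨D, d⟩ :: ⟨C, c⟩ :: L, rfl, rfl, fun i => ?_⟩
      match i with
      | 0 => rfl
      | 1 => rfl
      | i + 2 => rfl
  | trans e e' ih ih' =>
    intro L hL
    obtain ⟨L', hL', h1, h2⟩ := ih L hL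
    obtain ⟨L'', hL'', h3, h4⟩ := ih' L' hL'
    refine ⟨L'', hL'', ?_, fun i => (h2 i).trans (h4 _)⟩
    rw [trans_den, h1, h3]

theorem pos_surjective {β : Type w} {l l' : List β} (e : Exch l l') :
    Function.Surjective e.pos := by
  induction e with
  | nil => exact Function.surjective_id
  | cons a e ih =>
    intro i
    cases i with
    | zero => exact ⟨0, rfl⟩
    | succ i => obtain ⟨j, rfl⟩ := ih i; exact ⟨j + 1, rfl⟩
  | swap a b l =>
    intro i
    match i with
    | 0 => exact ⟨1, rfl⟩
    | 1 => exact ⟨0, rfl⟩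
    | i + 2 => exact ⟨i + 2, rfl⟩
  | trans e e' ih ih' => exact ih'.comp ih

theorem exch_den_eq {Γ Δ : List (Formula α)} (e e' : Exch Γ Δ) (h : e.pos = e'.pos) :
    e.den V = e'.den V := by
  apply LinearEquiv.toLinearMap_injective
  apply pureVec_ext
  intro L hL
  obtain ⟨L', hL', h1, h2⟩ := exch_pure e L hL
  obtain ⟨L'', hL'', h3, h4⟩ := exch_pure e' L hL
  have : L' = L'' := by
    apply List.ext_getElem?
    intro i
    obtain ⟨j, rfl⟩ := pos_surjective e i
    rw [← h2, h4, h]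
  subst this
  exact h1.trans h3.symm

section exch

variable {Γ Δ Θ : List (Formula α)} {A B X C : Formula α}

theorem ct_eq_app (a : A.den V) (x : denCtx V Γ) :
    ct a x = app (Γ := [A]) (ct a (nilVec V)) x := by
  rw [app_ct, app_nil]

theorem den_exch_swap (p : Prf (A :: B :: Γ) C) (a : A.den V) (b : B.den V) (x : denCtx V Γ) :
    (Prf.exch (Exch.swap A B Γ) p).den V (ct b (ct a x)) = p.den V (ct a (ct b x)) :=
  den_exch _ _ _ rfl

theorem den_exch_blocks (p : Prf (Γ ++ (Δ ++ Θ)) C) (x : denCtx V Γ) (y : denCtx V Δ)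
    (z : denCtx V Θ) :
    (Prf.exch (Exch.blocks Γ Δ Θ) p).den V (app y (app x z)) = p.den V (app x (app y z)) :=
  den_exch _ _ _ (blocks_den _ _ _ _ _ _)

theorem ct_ct_eq_app (a : A.den V) (b : B.den V) (x : denCtx V Γ) :
    ct a (ct b x) = app (Γ := [A, B]) (ct a (ct b (nilVec V))) x := by
  rw [app_ct, app_ct, app_nil]

theorem den_exch_one (p : Prf (A :: (Δ ++ Θ)) C) (a : A.den V) (y : denCtx V Δ)
    (z : denCtx V Θ) :
    (Prf.exch (Exch.blocks [A] Δ Θ) p).den V (app y (ct a z)) = p.den V (ct a (app y z)) := by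
  rw [ct_eq_app a z, ct_eq_app a (app y z)]
  exact den_exch_blocks (Γ := [A]) p _ _ _

theorem den_exch_to_one (p : Prf (Γ ++ A :: Θ) C) (a : A.den V) (x : denCtx V Γ)
    (z : denCtx V Θ) :
    (Prf.exch (Exch.blocks Γ [A] Θ) p).den V (ct a (app x z)) = p.den V (app x (ct a z)) := by
  rw [ct_eq_app a z, ct_eq_app a (app x z)]
  exact den_exch_blocks (Δ := [A]) p _ _ _

theorem den_exch_to_two (p : Prf (Γ ++ A :: B :: Θ) C) (a : A.den V) (b : B.den V)
    (x : denCtx V Γ) (z : denCtx V Θ) :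
    (Prf.exch (Exch.blocks Γ [A, B] Θ) p).den V (ct a (ct b (app x z))) =
      p.den V (app x (ct a (ct b z))) := by
  rw [ct_ct_eq_app a b z, ct_ct_eq_app a b (app x z)]
  exact den_exch_blocks (Δ := [A, B]) p _ _ _

theorem den_exch_two (p : Prf (A :: B :: X :: Θ) C) (a : A.den V) (b : B.den V) (c : X.den V)
    (z : denCtx V Θ) :
    (Prf.exch (Exch.blocks [A, B] [X] Θ) p).den V (ct c (ct a (ct b z))) =
      p.den V (ct a (ct b (ct c z))) := by
  rw [ct_ct_eq_app a b z, ct_ct_eq_app a b (ct c z)]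
  exact den_exch_to_one (Γ := [A, B]) p _ _ _

theorem den_exch_cons_one (p : Prf (A :: (Δ ++ X :: Θ)) C) (a : A.den V) (y : denCtx V Δ)
    (c : X.den V) (z : denCtx V Θ) :
    (Prf.exch (Exch.blocks (A :: Δ) [X] Θ) p).den V (ct c (ct a (app y z))) =
      p.den V (ct a (app y (ct c z))) :=
  den_exch_to_one (Γ := A :: Δ) p c (ct a y) z

theorem den_exch_cons (p : Prf (A :: (Δ ++ (Γ ++ Θ))) C) (a : A.den V) (y : denCtx V Δ)
    (x : denCtx V Γ) (z : denCtx V Θ) :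
    (Prf.exch (Exch.blocks (A :: Δ) Γ Θ) p).den V (app x (ct a (app y z))) =
      p.den V (ct a (app y (app x z))) :=
  den_exch_blocks (Γ := A :: Δ) p (ct a y) x z

theorem tt_ct_ext {M : Type*} [AddCommGroup M] [Module k M]
    {f g : denCtx V (tensor A B :: Γ) →ₗ[k] M}
    (h : ∀ a b x, f (ct (tt a b) x) = g (ct (tt a b) x)) : f = g := by
  apply ct_ext
  intro t x
  refine LinearMap.congr_fun (f := f ∘ₗ ct.flip x) (g := g ∘ₗ ct.flip x) ?_ t
  exact tt_ext fun a b => h a b x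

theorem app_tt_ct_ext {M : Type*} [AddCommGroup M] [Module k M]
    {f g : denCtx V (Γ ++ tensor A B :: Δ) →ₗ[k] M}
    (h : ∀ x a b y, f (app x (ct (tt a b) y)) = g (app x (ct (tt a b) y))) : f = g := by
  apply app_ext
  intro x y
  have : f ∘ₗ app x = g ∘ₗ app x := tt_ct_ext (h x)
  exact LinearMap.congr_fun this y

theorem app_ct_app_ext {M : Type*} [AddCommGroup M] [Module k M]
    {f g : denCtx V (Γ ++ A :: (Δ ++ Θ)) →ₗ[k] M}
    (h : ∀ x a y z, f (app x (ct a (app y z))) = g (app x (ct a (app y z)))) : f = g := by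
  apply app_ext
  intro x y
  have : f ∘ₗ app x = g ∘ₗ app x := ct_app_ext (h x)
  exact LinearMap.congr_fun this y

theorem ct_nil_ext {M : Type*} [AddCommGroup M] [Module k M] {f g : denCtx V [A] →ₗ[k] M}
    (h : ∀ a, f (ct a (nilVec V)) = g (ct a (nilVec V))) : f = g := by
  apply ct_ext
  intro a x
  have : f ∘ₗ ct a = g ∘ₗ ct a := nil_ext (h a)
  exact LinearMap.congr_fun this x

theorem tt_nil_ext {M : Type*} [AddCommGroup M] [Module k M]
    {f g : denCtx V [tensor A B] →ₗ[k] M}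
    (h : ∀ a b, f (ct (tt a b) (nilVec V)) = g (ct (tt a b) (nilVec V))) : f = g := by
  apply ct_nil_ext
  intro t
  have : f ∘ₗ ct.flip (nilVec V) = g ∘ₗ ct.flip (nilVec V) := tt_ext h
  exact LinearMap.congr_fun this t

theorem ct₂_ext {M : Type*} [AddCommGroup M] [Module k M]
    {f : denCtx V (bang A :: bang A :: Γ) →ₗ[k] M} {g : denCtx V (bang A :: bang A :: Δ) →ₗ[k] M}
    {x : denCtx V Γ} {y : denCtx V Δ} (h : ∀ a b, f (ct a (ct b x)) = g (ct a (ct b y))) (t) :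
    f (ct₂ t x) = g (ct₂ t y) :=
  dup_ext (f := f ∘ₗ ct₂.flip x) (g := g ∘ₗ ct₂.flip y) h t

theorem den_cut₁ (p : Prf Γ A) (q : Prf (A :: B :: Δ) C) (x : denCtx V Γ) (b : B.den V)
    (y : denCtx V Δ) :
    (Prf.cut p q).den V (app x (ct b y)) = q.den V (ct (p.den V x) (ct b y)) := den_cut _ _ _ _

theorem den_cut_ct (p : Prf (A :: Γ) B) (q : Prf (B :: Δ) C) (a : A.den V) (x : denCtx V Γ)
    (y : denCtx V Δ) :
    (Prf.cut p q).den V (ct a (app x y)) = q.den V (ct (p.den V (ct a x)) y) :=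
  den_cut p q (ct a x) y

end exch


/-! Promotions. -/

section coalg

variable {C D E W : Type u} [AddCommGroup C] [Module k C] [Coalgebra k C]
  [AddCommGroup D] [Module k D] [Coalgebra k D]
  [AddCommGroup E] [Module k E] [Coalgebra k E] [AddCommGroup W] [Module k W]

theorem lift_comp [Coalgebra.IsCocomm k C] [Coalgebra.IsCocomm k D] (h : C →ₗc[k] D) (f : D →ₗ[k] W) (x : C) :
    Bang.lift (f ∘ₗ h.toLinearMap) x = Bang.lift f (h x) := by
  apply Subtype.ext
  funext w
  exact LinearMap.congr_fun (wordCoeff_comp h f w) x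

theorem lift_d (x : Bang k W) : Bang.lift (Bang.d k W) x = x := by
  apply Subtype.ext
  funext w
  exact Bang.wordCoeff_d w x

variable (k C D E) in
theorem exists_leftComm : ∃ h : C ⊗[k] (D ⊗[k] E) →ₗc[k] D ⊗[k] (C ⊗[k] E),
    h.toLinearMap = (TensorProduct.leftComm k C D E).toLinearMap := by
  refine ⟨{ (TensorProduct.leftComm k C D E).toLinearMap with
    counit_comp := ?_, map_comp_comul := ?_ }, rfl⟩
  · ext x y z
    simp
    ring
  · ext x y z
    simp only [LinearMap.comp_apply, TensorProduct.AlgebraTensorModule.curry_apply,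
      LinearMap.restrictScalars_apply, TensorProduct.curry_apply, LinearEquiv.coe_coe,
      TensorProduct.leftComm_tmul, TensorProduct.comul_tmul]
    generalize Coalgebra.comul (R := k) x = s
    generalize Coalgebra.comul (R := k) y = t
    generalize Coalgebra.comul (R := k) z = r
    induction s with
    | zero => simp only [TensorProduct.zero_tmul, TensorProduct.tmul_zero, map_zero]
    | add _ _ h h' => simp only [TensorProduct.add_tmul, TensorProduct.tmul_add, map_add, h, h']
    | tmul s₁ s₂ =>
      induction t with
      | zero => simp only [TensorProduct.zero_tmul, TensorProduct.tmul_zero, map_zero]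
      | add _ _ h h' => simp only [TensorProduct.add_tmul, TensorProduct.tmul_add, map_add, h, h']
      | tmul t₁ t₂ =>
        induction r with
        | zero => simp only [TensorProduct.zero_tmul, TensorProduct.tmul_zero, map_zero]
        | add _ _ h h' => simp only [TensorProduct.add_tmul, TensorProduct.tmul_add, map_add, h, h']
        | tmul r₁ r₂ => simp

end coalg

theorem exists_exch {Γ Γ' : List (Formula α)} (e : Exch Γ Γ') :
    ∃ h : denCtx V (Γ.map bang) →ₗc[k] denCtx V (Γ'.map bang),
      h.toLinearMap = ((e.map bang).den V).toLinearMap := by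
  induction e with
  | nil => exact ⟨CoalgHom.id k k, rfl⟩
  | cons A e ih =>
    obtain ⟨h, hh⟩ := ih
    let h' := Coalgebra.TensorProduct.map (CoalgHom.id k (Bang k (A.den V))) h
    refine ⟨h', ?_⟩
    apply ct_ext
    intro a x
    exact congrArg (ct a) (LinearMap.congr_fun hh x)
  | swap A B Γ =>
    exact exists_leftComm k (Bang k (A.den V)) (Bang k (B.den V)) (denCtx V (Γ.map bang))
  | trans e e' ih ih' =>
    obtain ⟨h, hh⟩ := ih
    obtain ⟨h', hh'⟩ := ih'
    refine ⟨h'.comp h, ?_⟩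
    ext x
    exact (congrArg h' (LinearMap.congr_fun hh x)).trans (LinearMap.congr_fun hh' _)

theorem lift_exch {Γ Γ' : List (Formula α)} {A : Formula α} (e : Exch Γ Γ')
    (p : Prf (Γ.map bang) A) : (Prf.prom (Prf.exch (e.map bang) p)).den V =
      (Prf.exch (e.map bang) (Prf.prom p)).den V := by
  ext x
  obtain ⟨x, rfl⟩ := ((e.map bang).den V).surjective x
  obtain ⟨h, hh⟩ := exists_exch (V := V) e
  rw [den_exch _ _ x rfl, den_prom, den_prom, ← LinearEquiv.coe_coe, ← hh]
  refine (lift_comp h _ x).symm.trans ?_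
  refine congrArg (fun f => Bang.lift f x) ?_
  ext y
  exact (congrArg ((Prf.exch (e.map bang) p).den V) (LinearMap.congr_fun hh y)).trans
    (den_exch _ _ y rfl)

/-- The counit of `⟦!Γ⟧`. -/
noncomputable def epsCtx (Γ : List (Formula α)) : denCtx V (Γ.map bang) →ₗ[k] k :=
  Coalgebra.counit

theorem den_wks {Γ Δ : List (Formula α)} {B : Formula α} (q : Prf Δ B)
    (x : denCtx V (Γ.map bang)) (y : denCtx V Δ) :
    (Prf.wks q Γ).den V (app x y) = epsCtx Γ x • q.den V y := by
  induction Γ with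
  | nil =>
    have : (Prf.wks q []).den V ∘ₗ (app (Γ := [])).flip y =
        (epsCtx (V := V) []).smulRight (q.den V y) := by
      apply nil_ext
      simp only [LinearMap.comp_apply, LinearMap.flip_apply, app_nil, LinearMap.smulRight_apply]
      exact (one_smul k _).symm
    exact LinearMap.congr_fun this x
  | cons A Γ ih =>
    have : (Prf.wks q (A :: Γ)).den V ∘ₗ (app (Γ := bang A :: Γ.map bang)).flip y =
        (epsCtx (V := V) (A :: Γ)).smulRight (q.den V y) := by
      apply ct_ext
      intro a x
      simp only [LinearMap.comp_apply, LinearMap.flip_apply, app_ct, LinearMap.smulRight_apply]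
      refine (den_wk _ _ _ _).trans ?_
      rw [ih, smul_smul, mul_comm]
      rfl
    exact LinearMap.congr_fun this x

/-- The comultiplication of `⟦!Γ⟧`. -/
noncomputable def dupCtx (Γ : List (Formula α)) :
    denCtx V (Γ.map bang) →ₗ[k] denCtx V (Γ.map bang) ⊗[k] denCtx V (Γ.map bang) :=
  Coalgebra.comul

/-- `x₁ ⊗ x₂ ↦ f (x₁ ⊗ (x₂ ⊗ y))` -/
noncomputable def app₃ {Γ Γ' Δ : List (Formula α)} {M : Type*} [AddCommGroup M] [Module k M]
    (f : denCtx V (Γ ++ (Γ' ++ Δ)) →ₗ[k] M) (y : denCtx V Δ) :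
    denCtx V Γ ⊗[k] denCtx V Γ' →ₗ[k] M :=
  f ∘ₗ TensorProduct.lift (app.compl₂ (app.flip y))

theorem app₃_tmul {Γ Γ' Δ : List (Formula α)} {M : Type*} [AddCommGroup M] [Module k M]
    (f : denCtx V (Γ ++ (Γ' ++ Δ)) →ₗ[k] M) (y : denCtx V Δ) (x : denCtx V Γ) (x' : denCtx V Γ') :
    app₃ f y (x ⊗ₜ[k] x') = f (app x (app x' y)) := rfl

theorem comm_dup {A : Formula α} (a : (bang A).den V) :
    TensorProduct.comm k (Bang k (A.den V)) (Bang k (A.den V)) (dup a) = dup a :=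
  Coalgebra.comm_comul k (A := Bang k (A.den V)) a

theorem comm_tw {A : Formula α} (a b : (bang A).den V) :
    TensorProduct.comm k (Bang k (A.den V)) (Bang k (A.den V)) (tw a b) = tw b a := rfl

/-- The exchange of factors in the comultiplication of `⟦!A⟧ ⊗ ⟦!Γ⟧`. -/
noncomputable def ttt (A : Formula α) (Γ : List (Formula α)) :
    Bang k (A.den V) ⊗[k] Bang k (A.den V) →ₗ[k]
      denCtx V (Γ.map bang) ⊗[k] denCtx V (Γ.map bang) →ₗ[k]
      denCtx V ((A :: Γ).map bang) ⊗[k] denCtx V ((A :: Γ).map bang) :=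
  TensorProduct.curry (TensorProduct.tensorTensorTensorComm k (Bang k (A.den V))
    (Bang k (A.den V)) (denCtx V (Γ.map bang)) (denCtx V (Γ.map bang))).toLinearMap

theorem dupCtx_ct {A : Formula α} {Γ : List (Formula α)} (a : (bang A).den V)
    (x : denCtx V (Γ.map bang)) :
    dupCtx (A :: Γ) (ct a x) = ttt A Γ (dup a) (dupCtx Γ x) := rfl

theorem ttt_tmul {A : Formula α} {Γ : List (Formula α)} (a b : (bang A).den V)
    (x y : denCtx V (Γ.map bang)) :
    ttt A Γ (tw a b) (x ⊗ₜ[k] y) = TensorProduct.tmul k (M := denCtx V ((A :: Γ).map bang))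
      (N := denCtx V ((A :: Γ).map bang)) (ct a x) (ct b y) := rfl

open Prf in
theorem den_ctrs {B : Formula α} : ∀ (Γ Δ : List (Formula α))
    (p : Prf (Γ.map bang ++ (Γ.map bang ++ Δ)) B) (x : denCtx V (Γ.map bang)) (y : denCtx V Δ),
    (Prf.ctrs Γ Δ p).den V (app x y) = app₃ (p.den V) y (dupCtx Γ x)
  | [], Δ, p, x, y => by
    have : (Prf.ctrs [] Δ p).den V ∘ₗ (app (Γ := [])).flip y =
        app₃ (Γ := []) (Γ' := []) (p.den V) y ∘ₗ dupCtx (V := V) [] := by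
      apply nil_ext
      have h : dupCtx (V := V) [] (nilVec V) = nilVec V ⊗ₜ[k] nilVec V := rfl
      simp only [LinearMap.comp_apply, LinearMap.flip_apply]
      refine Eq.trans ?_ (congrArg _ h.symm)
      refine Eq.trans ?_ (app₃_tmul (Γ := []) (Γ' := []) _ _ _ _).symm
      refine congrArg (p.den V) ?_
      exact (app_nil _).symm
    exact LinearMap.congr_fun this x
  | A :: Γ, Δ, p, x, y => by
    have : (Prf.ctrs (A :: Γ) Δ p).den V ∘ₗ (app (Γ := bang A :: Γ.map bang)).flip y =
        app₃ (Γ := (A :: Γ).map bang) (Γ' := (A :: Γ).map bang) (p.den V) y ∘ₗ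
          dupCtx (V := V) (A :: Γ) := by
      apply ct_ext
      intro a x
      simp only [LinearMap.comp_apply, LinearMap.flip_apply, app_ct]
      refine Eq.trans ?_ (congrArg _ (dupCtx_ct a x).symm)
      unfold Prf.ctrs
      refine (den_exch_to_one _ _ _ _).trans ?_
      rw [den_ctrs Γ (bang A :: Δ)]
      generalize dupCtx Γ x = t
      induction t with
      | zero => simp only [map_zero]
      | add t t' h h' => simp only [map_add, h, h']
      | tmul x₁ x₂ =>
        rw [app₃_tmul]
        refine (den_exch _ _ (app x₁ (ct a (app x₂ y))) ?_).trans ?_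
        · rw [appendLeft_den]
          congr 1
          have := blocks_den (V := V) [bang A] (Γ.map bang) Δ (ct a (nilVec V)) x₂ y
          rwa [← ct_eq_app, ← ct_eq_app] at this
        refine (den_exch_one _ _ _ _).trans ?_
        refine (den_ctr _ _ _).trans ?_
        let q : Prf (bang A :: bang A :: (Γ.map bang ++ (Γ.map bang ++ Δ))) B :=
          exch (Exch.blocks (bang A :: Γ.map bang) [bang A] (Γ.map bang ++ Δ)) p
        refine (congrArg (fun d => q.den V (ct₂ d (app x₁ (app x₂ y)))) (comm_dup a).symm).trans ?_
        refine dup_ext (f := q.den V ∘ₗ ct₂.flip (app x₁ (app x₂ y)) ∘ₗ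
            (TensorProduct.comm k (Bang k (A.den V)) (Bang k (A.den V))).toLinearMap) (g := app₃ (Γ := (A :: Γ).map bang)
          (Γ' := (A :: Γ).map bang) (p.den V) y ∘ₗ (ttt A Γ).flip (x₁ ⊗ₜ[k] x₂)) (fun a b => ?_) _
        simp only [LinearMap.comp_apply, LinearMap.flip_apply, ttt_tmul, LinearEquiv.coe_coe, comm_tw, ct₂_tw]
        refine Eq.trans ?_ (app₃_tmul (Γ := (A :: Γ).map bang) (Γ' := (A :: Γ).map bang)
          _ _ _ _).symm
        refine den_exch _ _ _ ?_
        have := blocks_den (V := V) (bang A :: Γ.map bang) [bang A] (Γ.map bang ++ Δ) (ct a x₁)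
          (ct b (nilVec V)) (app x₂ y)
        rw [← ct_eq_app, ← ct_eq_app] at this
        exact this.trans rfl
    exact LinearMap.congr_fun this x

/-- The isomorphism `⟦!Γ⟧ ⊗ ⟦!Δ⟧ → ⟦!Γ, !Δ⟧` is a morphism of coalgebras. -/
theorem exists_appHom (Δ : List (Formula α)) : ∀ Γ : List (Formula α),
    ∃ h : denCtx V (Γ.map bang) ⊗[k] denCtx V (Δ.map bang) →ₗc[k] denCtx V ((Γ ++ Δ).map bang),
      ∀ x y, h (x ⊗ₜ[k] y) = castE List.map_append.symm (app x y)
  | [] => ⟨(Coalgebra.TensorProduct.lid k (denCtx V (Δ.map bang))).toCoalgHom, fun x y => rfl⟩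
  | A :: Γ => by
    obtain ⟨h, hh⟩ := exists_appHom Δ Γ
    let h' : denCtx V ((A :: Γ).map bang) ⊗[k] denCtx V (Δ.map bang) →ₗc[k]
      denCtx V ((A :: Γ ++ Δ).map bang) :=
     (Coalgebra.TensorProduct.map (CoalgHom.id k (Bang k (A.den V))) h).comp
      (Coalgebra.TensorProduct.assoc k k (Bang k (A.den V)) (denCtx V (Γ.map bang))
        (denCtx V (Δ.map bang))).toCoalgHom
    refine ⟨h', fun x y => ?_⟩
    refine LinearMap.congr_fun (f := LinearMap.comp h'.toLinearMap ((TensorProduct.mk k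
      (denCtx V ((A :: Γ).map bang)) (denCtx V (Δ.map bang))).flip y)) (g := LinearMap.comp
      (castE (List.map_append (l₁ := A :: Γ)).symm).toLinearMap (app.flip y)) ?_ x
    apply ct_ext
    intro a x
    refine (congrArg (ct a) (hh x y)).trans ?_
    exact (castE_ct (List.map_append (l₁ := A :: Γ)).symm a _).symm

theorem dd_prom {Γ : List (Formula α)} {A : Formula α} (p : Prf (Γ.map bang) A)
    (x : denCtx V (Γ.map bang)) : dd ((Prf.prom p).den V x) = p.den V x :=
  LinearMap.congr_fun (Bang.d_comp_lift (p.den V)) x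

theorem eps_prom {Γ : List (Formula α)} {A : Formula α} (p : Prf (Γ.map bang) A)
    (x : denCtx V (Γ.map bang)) : eps ((Prf.prom p).den V x) = epsCtx Γ x :=
  LinearMap.congr_fun (Bang.counit_comp_lift (p.den V)) x

/-- The map `x₁ ⊗ x₂ ↦ ⟦p⟧ x₁ ⊗ ⟦p⟧ x₂` for a promotion `p`. -/
noncomputable def promPair {Γ : List (Formula α)} {A : Formula α} (p : Prf (Γ.map bang) A) :
    denCtx V (Γ.map bang) ⊗[k] denCtx V (Γ.map bang) →ₗ[k]
      Bang k (A.den V) ⊗[k] Bang k (A.den V) :=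
  TensorProduct.map (Bang.lift (p.den V)) (Bang.lift (p.den V))

theorem promPair_tmul {Γ : List (Formula α)} {A : Formula α} (p : Prf (Γ.map bang) A)
    (x y : denCtx V (Γ.map bang)) :
    promPair p (x ⊗ₜ[k] y) = tw ((Prf.prom p).den V x) ((Prf.prom p).den V y) := rfl

theorem dup_prom {Γ : List (Formula α)} {A : Formula α} (p : Prf (Γ.map bang) A)
    (x : denCtx V (Γ.map bang)) : dup ((Prf.prom p).den V x) = promPair p (dupCtx Γ x) :=
  Bang.comul_lift (p.den V) x

theorem comm_dupCtx (Γ : List (Formula α)) (x : denCtx V (Γ.map bang)) :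
    TensorProduct.comm k (denCtx V (Γ.map bang)) (denCtx V (Γ.map bang)) (dupCtx Γ x) =
      dupCtx Γ x :=
  Coalgebra.comm_comul k (A := denCtx V (Γ.map bang)) x

theorem prom_prom_den {Γ Δ : List (Formula α)} {A B : Formula α} (p : Prf (Γ.map bang) A)
    (q : Prf ((A :: Δ).map bang) B) :
    (Prf.cut (Prf.prom p) (Prf.prom (Γ := A :: Δ) q)).den V =
      ((Prf.prom ((Prf.cut (Prf.prom p) q).cast
        (List.map_append (l₁ := Γ) (l₂ := Δ)).symm)).cast List.map_append).den V := by
  apply app_ext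
  intro x y
  obtain ⟨h, hh⟩ := exists_appHom (V := V) Δ Γ
  rw [den_cut, den_cast, den_prom, den_prom, ← hh]
  refine Eq.trans ?_ (lift_comp h _ _)
  let g := Coalgebra.TensorProduct.map (Bang.liftHom (p.den V))
    (CoalgHom.id k (denCtx V (Δ.map bang)))
  refine (lift_comp g (q.den V) (x ⊗ₜ[k] y)).symm.trans ?_
  refine congrArg (fun f => Bang.lift f (x ⊗ₜ[k] y)) ?_
  apply TensorProduct.ext'
  intro x y
  refine Eq.trans ?_ (congrArg (((Prf.cut (Prf.prom p) q).cast
        (List.map_append (l₁ := Γ) (l₂ := Δ)).symm).den V) (hh x y).symm)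
  rw [den_cast]
  have e : castE (V := V) (List.map_append (f := bang) (l₁ := Γ) (l₂ := Δ)) (castE
    (List.map_append (f := bang) (l₁ := Γ) (l₂ := Δ)).symm (app x y)) = app x y :=
    castE_symm_apply _ _ _ rfl
  refine Eq.trans ?_ (congrArg ((Prf.cut (Prf.prom p) q).den V) e).symm
  rw [den_cut]
  rfl

theorem eta_bang_den (A : Formula α) : (Prf.ax (bang A)).den V =
    (Prf.prom (Γ := [A]) (Prf.der (Prf.ax A))).den V := by
  apply ct_nil_ext
  intro a
  rw [den_ax]
  refine Eq.trans ?_ (den_prom (Γ := [A]) _ _).symm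
  let h : Bang k (A.den V) ⊗[k] k →ₗc[k] Bang k (A.den V) :=
    (Coalgebra.TensorProduct.rid k k (Bang k (A.den V))).toCoalgHom
  have hf : (Prf.der (Prf.ax A)).den V = Bang.d k (A.den V) ∘ₗ h.toLinearMap := by
    apply ct_nil_ext
    intro a
    rw [den_der, den_ax]
    exact (congrArg (Bang.d k (A.den V)) (one_smul k a)).symm
  let z : Bang k (A.den V) ⊗[k] k := TensorProduct.tmul k (M := Bang k (A.den V)) a (1 : k)
  have h1 := lift_comp h (Bang.d k (A.den V)) z
  rw [lift_d] at h1
  refine Eq.trans ?_ (h1.symm.trans (congrArg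
    (fun f : Bang k (A.den V) ⊗[k] k →ₗ[k] A.den V => Bang.lift f z) hf.symm))
  exact (one_smul k a).symm

open Prf in
theorem step_den {Γ : List (Formula α)} {A : Formula α} {p q : Prf Γ A} (h : Prf.Step p q) :
    p.den V = q.den V := by
  cases h with
  | exch_refl p => exact LinearMap.ext fun x => den_exch _ _ x (refl_den _ _)
  | exch_trans e e' p => rfl
  | exch_pos e e' h p =>
    change p.den V ∘ₗ _ = p.den V ∘ₗ _
    rw [exch_den_eq e e' h]
  | exch_cut e e' p q =>
    apply app_ext; intro x y
    obtain ⟨x, rfl⟩ := (e.den V).surjective x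
    obtain ⟨y, rfl⟩ := (e'.den V).surjective y
    rw [den_cut, den_exch e p x rfl, den_exch _ _ _ (append_den e e' x y), den_cut,
      den_exch _ _ _ (cons_den e' _ y)]
  | exch_tensorR e e' p q =>
    apply app_ext; intro x y
    obtain ⟨x, rfl⟩ := (e.den V).surjective x
    obtain ⟨y, rfl⟩ := (e'.den V).surjective y
    rw [den_tensorR, den_exch e p x rfl, den_exch _ _ _ (append_den e e' x y), den_tensorR,
      den_exch e' q y rfl]
  | exch_tensorL e p =>
    apply tt_ct_ext; intro a b x
    obtain ⟨x, rfl⟩ := (e.den V).surjective x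
    rw [den_tensorL, den_exch _ _ _ (cons_den e _ x), den_tensorL]
    exact den_exch _ _ _ rfl
  | exch_lolliR e p =>
    ext x
    obtain ⟨x, rfl⟩ := (e.den V).surjective x
    apply ev_ext; intro a
    rw [den_lolliR, den_exch _ _ _ (cons_den e a x), den_exch e _ x rfl, den_lolliR]
  | exch_lolliL e e' p q =>
    apply ct_app_ext; intro a x y
    obtain ⟨x, rfl⟩ := (e.den V).surjective x
    obtain ⟨y, rfl⟩ := (e'.den V).surjective y
    rw [den_lolliL, den_exch e p x rfl, den_exch _ _ _ (cons_den e' _ y),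
      den_exch ((e.append e').cons (Formula.lolli _ _)) _ (ct a (app x y))
        (congrArg (ct a) (append_den e e' x y)), den_lolliL]
  | exch_ampR e p q => rfl
  | exch_ampL0 B e p =>
    apply ct_ext; intro a x
    obtain ⟨x, rfl⟩ := (e.den V).surjective x
    rw [den_ampL0, den_exch _ _ _ (cons_den e _ x), den_exch _ _ _ (cons_den e _ x), den_ampL0]
  | exch_ampL1 A e p =>
    apply ct_ext; intro a x
    obtain ⟨x, rfl⟩ := (e.den V).surjective x
    rw [den_ampL1, den_exch _ _ _ (cons_den e _ x), den_exch _ _ _ (cons_den e _ x), den_ampL1]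
  | exch_prom e p => exact lift_exch e p
  | exch_der e p =>
    apply ct_ext; intro a x
    obtain ⟨x, rfl⟩ := (e.den V).surjective x
    rw [den_der, den_exch _ _ _ (cons_den e _ x), den_exch _ _ _ (cons_den e _ x), den_der]
  | exch_ctr e p =>
    apply ct_ext; intro a x
    obtain ⟨x, rfl⟩ := (e.den V).surjective x
    rw [den_ctr, den_exch _ _ _ (cons_den e _ x), den_ctr]
    refine ct₂_ext (fun a b => ?_) _
    exact den_exch _ _ _ rfl
  | exch_wk A e p =>
    apply ct_ext; intro a x
    obtain ⟨x, rfl⟩ := (e.den V).surjective x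
    rw [den_wk, den_exch _ _ _ (cons_den e _ x), den_exch e _ x rfl, den_wk]
  | ax_cut q =>
    apply ct_ext
    intro a x
    have := den_cut (V := V) (ax _) q (ct a (nilVec V)) x
    rwa [den_ax, app_ct, app_nil] at this
  | @cut_ax Γ A p =>
    apply app_ext (Γ := Γ) (Δ := [])
    intro x y
    have : (cut p (ax A)).den V ∘ₗ app x =
        (p.cast (List.append_nil Γ).symm).den V ∘ₗ app x := by
      apply nil_ext
      rw [LinearMap.comp_apply, LinearMap.comp_apply, den_cut, den_ax, den_cast, castE_append_nil]
    exact LinearMap.congr_fun this y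
  | tensor_cut p q s =>
    apply app₃_ext'
    intro x y z
    rw [den_cast, castE_assoc, den_cut, den_tensorR, den_tensorL, den_cut, den_exch_to_one, den_cut,
      den_exch_swap]
  | lolli_cut p q s =>
    apply app₃_ext
    intro x y z
    rw [den_cut, den_lolliL, den_lolliR, den_exch_blocks, den_cast, castE_assoc_symm, den_cut,
      den_cut]
  | amp_cut0 p q s => apply app_ext; intro x y; simp only [den_cut, den_ampL0, den_ampR₀]
  | amp_cut1 p q s => apply app_ext; intro x y; simp only [den_cut, den_ampL1, den_ampR₁]
  | prom_der p q =>
    apply app_ext; intro x y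
    rw [den_cut, den_der, den_cut, dd_prom]
  | prom_wk p q =>
    apply app_ext; intro x y
    rw [den_cut, den_wk, den_wks, eps_prom]
  | @prom_ctr Γ Δ A B p q =>
    apply app_ext; intro x y
    rw [den_cut, den_ctr, den_ctrs, dup_prom]
    conv_lhs => rw [← comm_dupCtx]
    generalize dupCtx Γ x = t
    induction t with
    | zero => simp only [map_zero, LinearMap.zero_apply]
    | add t t' h h' => simp only [map_add, LinearMap.add_apply, h, h']
    | tmul x₁ x₂ =>
      rw [TensorProduct.comm_tmul, app₃_tmul, promPair_tmul, ct₂_tw, den_cut, den_exch_to_one,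
        den_cut]
  | prom_prom p q => exact prom_prom_den p q
  | cut_left p q s =>
    apply app₃_ext'; intro x y z
    rw [den_cast, castE_assoc, den_cut, den_cut, den_cut]
    exact (den_cut_ct q s _ y z).symm
  | tensorL_left p s =>
    apply tt_ct_ext; intro a b y
    have : (cut (tensorL p) s).den V ∘ₗ ct (tt a b) = (tensorL (cut p s)).den V ∘ₗ ct (tt a b) := by
      apply app_ext; intro x y
      simp only [LinearMap.comp_apply]
      rw [den_cut_ct, den_tensorL, den_tensorL]
      exact (den_cut_ct p s a (ct b x) y).symm
    exact LinearMap.congr_fun this y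
  | @lolliL_left Γ Δ Θ A B C D p q s =>
    apply ct_ext; intro a w
    have : (cut (lolliL p q) s).den V ∘ₗ ct a = ((lolliL p (cut q s)).cast
          (congrArg (List.cons (Formula.lolli A B)) (List.append_assoc Γ Δ Θ).symm)).den V ∘ₗ
            ct a := by
      apply app₃_ext'; intro x y z
      simp only [LinearMap.comp_apply]
      rw [den_cut_ct, den_lolliL, den_cast]
      have e := castE_ct (V := V) (congrArg (List.cons (Formula.lolli A B))
        (List.append_assoc Γ Δ Θ).symm).symm a (app (app x y) z)
      rw [e, castE_assoc, den_lolliL, den_cut_ct]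
    exact LinearMap.congr_fun this w
  | ampL0_left B p s =>
    apply ct_app_ext; intro a x y
    rw [den_cut_ct, den_ampL0, den_ampL0, den_cut_ct]
  | ampL1_left A p s =>
    apply ct_app_ext; intro a x y
    rw [den_cut_ct, den_ampL1, den_ampL1, den_cut_ct]
  | der_left p s =>
    apply ct_app_ext; intro a x y
    rw [den_cut_ct, den_der, den_der, den_cut_ct]
  | ctr_left p s =>
    apply ct_app_ext; intro a x y
    rw [den_cut_ct, den_ctr, den_ctr]
    refine dup_ext (f := s.den V ∘ₗ ct.flip y ∘ₗ p.den V ∘ₗ ct₂.flip x)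
      (g := (cut p s).den V ∘ₗ ct₂.flip (app x y)) (fun a b => ?_) _
    simp only [LinearMap.comp_apply, LinearMap.flip_apply, ct₂_tw]
    exact (den_cut_ct p s a (ct b x) y).symm
  | wk_left A p s =>
    apply ct_app_ext; intro a x y
    rw [den_cut_ct, den_wk, den_wk, den_cut, map_smul, LinearMap.smul_apply, map_smul]
  | cut_right p q s =>
    apply app₃_ext; intro x y z
    rw [den_cut, den_exch_to_one, den_cut, den_exch_swap, den_exch_blocks, den_cut, den_exch_to_one]
    exact (den_cut₁ _ _ _ _ _).symm
  | tensorR_right₁ p q s =>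
    apply app₃_ext; intro x y z
    rw [den_cast, castE_assoc_symm, den_tensorR, den_cut, den_cut]
    exact den_tensorR q s (ct _ y) z
  | tensorR_right₂ p q s =>
    apply app₃_ext; intro x y z
    rw [den_cut, den_exch_to_one, den_tensorR, den_exch_blocks, den_tensorR, den_cut]
  | tensorL_right p q =>
    apply app_tt_ct_ext; intro x a b y
    rw [den_cut₁, den_exch_swap, den_tensorL, den_exch_one, den_tensorL, den_exch_to_two]
    exact ((den_cut₁ _ _ _ _ _).trans (den_exch_two _ _ _ _ _)).symm
  | lolliR_right p q =>
    apply app_ext; intro x y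
    apply ev_ext; intro a
    rw [den_lolliR, den_exch_to_one, den_cut, den_lolliR, den_cut₁, den_exch_swap]
  | @lolliL_right₁ Γ Δ Θ X A B C p q s =>
    apply app_ct_app_ext; intro x f y z
    rw [den_cut₁, den_exch_swap, den_exch_one, den_cast]
    have e := castE_ct (V := V) (congrArg (List.cons (Formula.lolli A B))
        (List.append_assoc Γ Δ Θ)).symm f (app x (app y z))
    rw [e, castE_assoc_symm, den_lolliL, den_cut]
    exact den_lolliL q s f (ct _ y) z
  | lolliL_right₂ p q s =>
    apply app_ct_app_ext; intro x f y z
    rw [den_cut₁, den_exch_cons_one, den_lolliL, den_exch_cons, den_lolliL, den_exch_to_one,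
      den_cut₁, den_exch_swap]
  | ampR_right p q s =>
    apply app_ext; intro x y
    apply pr_ext <;> simp only [den_cut, den_ampR₀, den_ampR₁]
  | ampL0_right B p q =>
    apply app_ct_ext; intro x a y
    rw [den_cut₁, den_exch_swap, den_ampL0, den_exch_one, den_ampL0, den_exch_to_one, den_cut₁,
      den_exch_swap]
  | ampL1_right A p q =>
    apply app_ct_ext; intro x a y
    rw [den_cut₁, den_exch_swap, den_ampL1, den_exch_one, den_ampL1, den_exch_to_one, den_cut₁,
      den_exch_swap]
  | der_right p q =>
    apply app_ct_ext; intro x a y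
    rw [den_cut₁, den_exch_swap, den_der, den_exch_one, den_der, den_exch_to_one, den_cut₁,
      den_exch_swap]
  | ctr_right p q =>
    apply app_ct_ext; intro x a y
    rw [den_cut₁, den_exch_swap, den_ctr, den_exch_one, den_ctr]
    refine ct₂_ext (fun a b => ?_) _
    rw [den_exch_to_two]
    exact ((den_cut₁ _ _ _ _ _).trans (den_exch_two _ _ _ _ _)).symm
  | wk_right A p q =>
    apply app_ct_ext; intro x a y
    rw [den_cut₁, den_exch_swap, den_wk, den_exch_one, den_wk, den_cut]
  | eta_tensor A B =>
    apply tt_nil_ext; intro a b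
    rw [den_ax, den_tensorL]
    have h := den_tensorR (V := V) (ax A) (ax B) (ct a (nilVec V)) (ct b (nilVec V))
    rw [den_ax, den_ax, app_ct, app_nil] at h
    exact h.symm
  | eta_lolli A B =>
    apply ct_nil_ext; intro f
    apply ev_ext; intro a
    rw [den_ax, den_lolliR, den_exch_swap]
    have h := den_lolliL (V := V) (ax A) (ax B) f (ct a (nilVec V)) (nilVec V)
    rw [den_ax, den_ax, app_ct, app_nil] at h
    exact h.symm
  | eta_amp A B =>
    apply ct_nil_ext; intro a
    apply pr_ext
    · rw [den_ax, den_ampR₀, den_ampL0, den_ax]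
    · rw [den_ax, den_ampR₁, den_ampL1, den_ax]
  | eta_bang A => exact (eta_bang_den A)


open Prf in
theorem cutEquiv_den {Γ : List (Formula α)} {A : Formula α} {p q : Prf Γ A}
    (h : Prf.CutEquiv p q) : p.den V = q.den V := by
  induction h with
  | step h => exact step_den h
  | refl p => rfl
  | symm _ ih => exact ih.symm
  | trans _ _ ih ih' => exact ih.trans ih'
  | exch e _ ih => simp only [Prf.den, ih]
  | cut _ _ ih ih' => simp only [Prf.den, ih, ih']
  | tensorR _ _ ih ih' => simp only [Prf.den, ih, ih']
  | tensorL _ ih => simp only [Prf.den, ih]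
  | lolliR _ ih => simp only [Prf.den, ih]; rfl
  | lolliL _ _ ih ih' => simp only [Prf.den, ih, ih']
  | ampR _ _ ih ih' => simp only [Prf.den, ih, ih']; rfl
  | ampL0 B _ ih => simp only [Prf.den, ih]
  | ampL1 A _ ih => simp only [Prf.den, ih]
  | prom _ ih => simp only [Prf.den, ih]; rfl
  | der _ ih => simp only [Prf.den, ih]
  | ctr _ ih => simp only [Prf.den, ih]
  | wk A _ ih => simp only [Prf.den, ih]

end Invariance

/-- The denotation of a closed proof modulo cut-elimination, as an element of the denotation of the
formula proved. -/
noncomputable def ProofClass.den {A : Formula α} : ProofClass [] A → A.den V :=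
  Quotient.lift (fun p => p.den V (1 : k)) fun _ _ h => by rw [cutEquiv_den h]

/-- The linear extension `k𝒫 → ⟦A⟧` of the denotation. -/
noncomputable def denLin {A : Formula α} (P : Finset (ProofClass [] A)) :
    (P →₀ k) →ₗ[k] A.den V :=
  Finsupp.linearCombination k fun ρ : P => ProofClass.den V ρ.1

/-- `ι(ω₁, …, ω_r) = |∅⟩_{⟦ω₁⟧} ⊗ ⋯ ⊗ |∅⟩_{⟦ω_r⟧}`. -/
noncomputable def vacuum {r : ℕ} (A : Fin r → Formula α) (P : ∀ i, Finset (ProofClass [] (A i)))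
    (ω : ∀ i, P i →₀ k) : denCtx V ((List.finRange r).map fun i => bang (A i)) :=
  ctxVec V (fun i => bang (A i)) (fun i => Bang.ket (k := k) (denLin V (P i) (ω i)))
    (List.finRange r)

end Semantics

section Polynomial

variable {α : Type v} {r : ℕ} {n : Fin r → ℕ} {A : Fin r → Formula α} {B : Formula α}

/-- `π(ρ_{γ₁}, …, ρ_{γ_r})`, the result of cutting `π` against the proofs `γ i j`. -/
def ProofClass.subst (π : Prf ((slots n).map fun s => A s.1) B)
    {P : ∀ i, Finset (ProofClass [] (A i))} (γ : ∀ i, Fin (n i) → P i) : ProofClass [] B :=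
  ProofClass.plug (A := fun s : Slot n => A s.1) (fun s => (γ s.1 s.2).1) (slots n)
    (Quotient.mk _ π)

variable (k : Type u) [Field k]

/-- The variable `y_τ` of `Sym(k𝒬)`. -/
noncomputable def yVar {Q : Finset (ProofClass [] B)} (τ : Q) : SymmetricAlgebra k (Q →₀ k) :=
  SymmetricAlgebra.ι k (Q →₀ k) (Finsupp.single τ 1)

/-- The variable `x^i_ρ` of `Sym(k𝒫₁ ⊕ ⋯ ⊕ k𝒫_r)`. -/
noncomputable def xVar {P : ∀ i, Finset (ProofClass [] (A i))} (i : Fin r) (ρ : P i) :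
    SymmetricAlgebra k (DirectSum (Fin r) fun i => P i →₀ k) :=
  SymmetricAlgebra.ι k (DirectSum (Fin r) fun i => P i →₀ k)
    (DirectSum.lof k (Fin r) (fun i => P i →₀ k) i (Finsupp.single ρ 1))

open Classical in
/-- The polynomial `f_ψ^τ`: the sum over all `γ` with `π(ρ_{γ₁}, …, ρ_{γ_r}) = τ` of the monomials
`∏ᵢ ∏ⱼ x^i_{γᵢ(j)}`. -/
noncomputable def plainPoly (π : Prf ((slots n).map fun s => A s.1) B)
    (P : ∀ i, Finset (ProofClass [] (A i))) (τ : ProofClass [] B) :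
    SymmetricAlgebra k (DirectSum (Fin r) fun i => P i →₀ k) :=
  ∑ γ : ∀ i, Fin (n i) → P i,
    if τ = ProofClass.subst π γ then ∏ i, ∏ j, xVar k i (γ i j) else 0

variable {k}

/-- Evaluation of the elements of `Sym(k𝒬)`, as polynomials in the `y_τ`, at a point of `k𝒬`. -/
noncomputable def evalY {Q : Finset (ProofClass [] B)} (b : Q →₀ k) :
    SymmetricAlgebra k (Q →₀ k) →ₐ[k] k :=
  SymmetricAlgebra.lift (Finsupp.linearCombination k fun τ => b τ)

/-- Evaluation of the elements of `Sym(k𝒫₁ ⊕ ⋯ ⊕ k𝒫_r)`, as polynomials in the `x^i_ρ`, at a point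
of `k𝒫₁ × ⋯ × k𝒫_r`. -/
noncomputable def evalX {P : ∀ i, Finset (ProofClass [] (A i))} (a : ∀ i, P i →₀ k) :
    SymmetricAlgebra k (DirectSum (Fin r) fun i => P i →₀ k) →ₐ[k] k :=
  SymmetricAlgebra.lift
    (DirectSum.toModule k (Fin r) k fun i => Finsupp.linearCombination k fun ρ => a i ρ)

theorem evalY_yVar {Q : Finset (ProofClass [] B)} (b : Q →₀ k) (τ : Q) :
    evalY b (yVar k τ) = b τ := by
  simp [evalY, yVar]

theorem evalX_xVar {P : ∀ i, Finset (ProofClass [] (A i))} (a : ∀ i, P i →₀ k) (i : Fin r)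
    (ρ : P i) : evalX a (xVar k i ρ) = a i ρ := by
  simp [evalX, xVar]

end Polynomial

end LinearLogic

/-! The vacuum vector over `p` enters only through three identities: the map `d` sends it to `p`,
its comultiplication is its own tensor square, and its counit is `1`. These are exactly what
dereliction, contraction and weakening see. Fix points `p i` of `⟦A i⟧` and evaluate every proof in
a plain derivation at the vector with `p i` at each copy of `A i` and the vacuum vector over `p i`
at each copy of `!(A i)`. No rule of the derivation changes the resulting value, so at the end `⟦ψ⟧`
of the tensor product of the vacuum vectors equals `⟦π⟧` of the tensor product of the `p i`, each
repeated `n i` times (`PlainDerivation.den_ctxVec`, `IsPlainFrom.den_ctxVec`). Passing from `ψ` to a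
proof literally obtained from `π` costs nothing, since denotations are invariant under
cut-elimination.

Now let `p i` be the linear combination of the `⟦ρ⟧`, for `ρ` in `P i`, with coefficients `ω i ρ`.
The tensor product is multilinear (`ctxVec_sum_smul`), so `⟦π⟧` of it is a sum over all choices `γ`
of a proof for each hypothesis of `π`, weighted by the product of the chosen coefficients. The
vector occurring with `γ` is the denotation of `π` cut against the chosen proofs, because cutting
against a closed proof is substitution of its denotation (`ProofClass.den_plug`). The result is
`IsPlainFrom.den_vacuum`.

All these proofs lie in `Q`, so the sum is the image of an explicit element of the free vector space
on `Q`, which defines `F`. Linear independence of the denotations makes the linear extension on that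
space injective, hence `F` is unique. Collecting the terms with `π(γ) = τ` shows that the
`τ`-coordinate of `F ω` is the value of the stated polynomial at `ω` (`evalX_plainPoly`). Two
algebra morphisms on a symmetric algebra that agree on the generators agree everywhere, and this
gives the statement about all polynomials on the target. -/

namespace LinearLogic

/-! ### Tensor products of labelled vectors: relabelling, exchange, multilinearity. -/

section ContextVectors

open Formula

variable {k : Type u} [Field k] {α : Type v} {V : α → ModuleCat.{u} k} {σ : Type}

theorem ctxVec_cons (A : σ → Formula α) (v : ∀ s, (A s).den V) (s : σ) (ls : List σ) :
    ctxVec V A v (s :: ls) = ct (v s) (ctxVec V A v ls) := rfl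

/-- A plain derivation starts from the slots and ends with the indices `i`, both embedded in a
common set of labels. The resulting contexts agree with the intended ones only up to `List.map_map`,
and this lemma carries pure tensors across that equality. -/
theorem castE_ctxVec_map {τ : Type} (f : τ → σ) (A : σ → Formula α) (v : ∀ s, (A s).den V)
    (ls : List τ) (h : (ls.map f).map A = ls.map (A ∘ f)) :
    castE h (ctxVec V A v (ls.map f)) = ctxVec V (A ∘ f) (fun t => v (f t)) ls := by
  induction ls with
  | nil => rfl
  | cons t ls ih => exact (castE_ct h (v (f t)) _).trans (congrArg (ct (v (f t))) (ih _))

/-- The vector at a position depends only on the label there, so permuting the labels permutes the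
tensor factors along with them. Repeated labels cause no ambiguity, as they carry the same vector.
-/
theorem exch_den_ctxVec (A : σ → Formula α) (v : ∀ s, (A s).den V) {ls ls' : List σ}
    (e : Exch ls ls') : (e.map A).den V (ctxVec V A v ls) = ctxVec V A v ls' := by
  induction e with
  | nil => rfl
  | cons s e ih => exact congrArg (ct (v s)) ih
  | swap s t ls => rfl
  | trans e e' ih ih' => exact (congrArg ((e'.map A).den V) ih).trans ih'

theorem ctxVec_congr (A : σ → Formula α) {v v' : ∀ s, (A s).den V} {ls : List σ}
    (h : ∀ s ∈ ls, v s = v' s) : ctxVec V A v ls = ctxVec V A v' ls := by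
  induction ls with
  | nil => rfl
  | cons s ls ih =>
    rw [ctxVec_cons, ctxVec_cons, h s (by simp), ih fun t ht => h t (by simp [ht])]

/-- The absence of repetitions is essential: a label occurring twice would contribute its vector to
two factors, and the dependence on that vector would be quadratic. -/
theorem ctxVec_update_add [DecidableEq σ] (A : σ → Formula α) (v : ∀ s, (A s).den V) {ls : List σ}
    (hls : ls.Nodup) {s : σ} (hs : s ∈ ls) (a b : (A s).den V) :
    ctxVec V A (Function.update v s (a + b)) ls =
      ctxVec V A (Function.update v s a) ls + ctxVec V A (Function.update v s b) ls := by
  induction ls with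
  | nil => simp at hs
  | cons t ls ih =>
    obtain ⟨ht, hls⟩ := List.nodup_cons.1 hls
    simp only [ctxVec_cons]
    by_cases h : s = t
    · subst h
      -- The updated label is the head, so by the absence of repetitions the tail does not see the
      -- update, and additivity is that of the first tensor factor.
      have e (c : (A s).den V) : ctxVec V A (Function.update v s c) ls = ctxVec V A v ls :=
        ctxVec_congr A fun t' ht' => Function.update_of_ne (ne_of_mem_of_not_mem ht' ht) _ _
      simp only [e, Function.update_self, map_add, LinearMap.add_apply]
    · simp only [Function.update_of_ne (Ne.symm h)]
      rw [ih hls ((List.mem_cons.1 hs).resolve_left h), map_add]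

theorem ctxVec_update_smul [DecidableEq σ] (A : σ → Formula α) (v : ∀ s, (A s).den V)
    {ls : List σ} (hls : ls.Nodup) {s : σ} (hs : s ∈ ls) (c : k) (a : (A s).den V) :
    ctxVec V A (Function.update v s (c • a)) ls =
      c • ctxVec V A (Function.update v s a) ls := by
  induction ls with
  | nil => simp at hs
  | cons t ls ih =>
    obtain ⟨ht, hls⟩ := List.nodup_cons.1 hls
    simp only [ctxVec_cons]
    by_cases h : s = t
    · subst h
      have e (c : (A s).den V) : ctxVec V A (Function.update v s c) ls = ctxVec V A v ls :=
        ctxVec_congr A fun t' ht' => Function.update_of_ne (ne_of_mem_of_not_mem ht' ht) _ _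
      simp only [e, Function.update_self, map_smul, LinearMap.smul_apply]
    · simp only [Function.update_of_ne (Ne.symm h)]
      rw [ih hls ((List.mem_cons.1 hs).resolve_left h), map_smul]

variable (V) in
/-- `v ↦ ⨂ v s` as a multilinear map, for an enumeration of the labels without repetitions. -/
noncomputable def ctxVecMultilinear (A : σ → Formula α) {ls : List σ} (hls : ls.Nodup)
    (hmem : ∀ s, s ∈ ls) : MultilinearMap k (fun s => (A s).den V) (denCtx V (ls.map A)) where
  toFun v := ctxVec V A v ls
  map_update_add' := by
    intro _ v s a b
    convert ctxVec_update_add A v hls (hmem s) a b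
  map_update_smul' := by
    intro _ v s c a
    convert ctxVec_update_smul A v hls (hmem s) c a

/-- Distributivity of the tensor product, the source of the sum over `γ` in the final formula: `γ`
picks one summand from each factor. Every label occurs exactly once in `ls`, so the scalars that
come out form the product over all labels. -/
theorem ctxVec_sum_smul [Fintype σ] [DecidableEq σ] (A : σ → Formula α) {ls : List σ}
    (hls : ls.Nodup) (hmem : ∀ s, s ∈ ls) {β : σ → Type v} [∀ s, Fintype (β s)]
    (c : ∀ s, β s → k) (x : ∀ s, β s → (A s).den V) :
    ctxVec V A (fun s => ∑ b, c s b • x s b) ls =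
      ∑ γ : ∀ s, β s, (∏ s, c s (γ s)) • ctxVec V A (fun s => x s (γ s)) ls := by
  refine ((ctxVecMultilinear V A hls hmem).map_sum fun s b => c s b • x s b).trans ?_
  exact Finset.sum_congr rfl fun γ _ =>
    (ctxVecMultilinear V A hls hmem).map_smul_univ (fun s => c s (γ s)) fun s => x s (γ s)

end ContextVectors

/-! ### The slots are enumerated exactly once. -/

section Slots

variable {r : ℕ} (n : Fin r → ℕ)

theorem mem_slots (s : Slot n) : s ∈ slots n := by
  simp only [slots, List.mem_flatMap, List.mem_map, List.mem_finRange, true_and]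
  exact ⟨s.1, s.2, rfl⟩

theorem nodup_slots : (slots n).Nodup := by
  rw [slots, List.nodup_flatMap]
  refine ⟨fun i _ => (List.nodup_finRange _).map fun j j' h => by simpa using h, ?_⟩
  -- The first component of a slot records the block it comes from, so blocks belonging to distinct
  -- indices are disjoint.
  refine (List.nodup_finRange r).imp fun {i i'} h s hs hs' => ?_
  obtain ⟨j, -, rfl⟩ := List.mem_map.1 hs
  obtain ⟨j', -, h'⟩ := List.mem_map.1 hs'
  exact h (congrArg Sigma.fst h').symm

end Slots

/-! ### Values of plain proofs at vacuum vectors. -/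

section Denotation

open Formula

variable {k : Type u} [Field k] {α : Type v} (V : α → ModuleCat.{u} k)

/-- The denotation of a cut is a composition. When the left premise is closed, the cut inserts the
denotation of that premise, a single vector, into the first tensor factor; repeating this fills all
the factors. -/
theorem ProofClass.den_plug {σ : Type} {A : σ → Formula α} {B : Formula α}
    (X : ∀ s, ProofClass [] (A s)) (ls : List σ) (π : Prf (ls.map A) B) :
    ProofClass.den V (ProofClass.plug X ls (Quotient.mk _ π)) =
      π.den V (ctxVec V A (fun s => ProofClass.den V (X s)) ls) := by
  induction ls with
  | nil => rfl
  | cons s ls ih =>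
    obtain ⟨p, hp⟩ := Quotient.exists_rep (X s)
    -- Once a representative `p` of `X s` is chosen, the first cut is an actual proof, to which the
    -- induction hypothesis applies in place of `π`.
    have h1 : ProofClass.plug X (s :: ls) (Quotient.mk _ π) =
        ProofClass.plug X ls (Quotient.mk _ (Prf.cut (Γ := []) (Δ := ls.map A) p π)) := by
      change ProofClass.plug X ls (ProofClass.cut (X s) (Quotient.mk _ π)) = _
      rw [← hp]
      rfl
    -- The left context of the cut is empty, so its vector is the unit `nilVec V`, which `app_nil`
    -- then absorbs.
    have h2 := den_cut (V := V) p π (nilVec V) (ctxVec V A (fun s => ProofClass.den V (X s)) ls)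
    rw [app_nil] at h2
    rw [h1, ih, ctxVec_cons, ← hp]
    exact h2

variable {r : ℕ} {n : Fin r → ℕ} {A : Fin r → Formula α} {B : Formula α}

variable {V} in
/-- The vector `p i` at each copy of `A i` and the vacuum vector over `p i` at each copy of
`!(A i)`. -/
noncomputable def hypVec (p : ∀ i, (A i).den V) : ∀ s : Slot n ⊕ Fin r, (hyp A s).den V
  | Sum.inl s => p s.1
  | Sum.inr i => Bang.ket (k := k) (p i)

variable {V} in
-- The value at `hypVec p` is an invariant of the derivation. Exchange permutes factors together
-- with their labels. Dereliction replaces the vacuum vector over `p i` by its image `p i` under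
-- `d`. Contraction duplicates the vacuum vector, because it is group-like, and weakening multiplies
-- by its counit, which is `1`. What remains at the top is `π` evaluated at copies of the `p i`.
theorem PlainDerivation.den_ctxVec {π : Prf ((slots n).map fun s => A s.1) B}
    {ls : List (Slot n ⊕ Fin r)} {q : Prf (ls.map (hyp A)) B} (h : PlainDerivation A π ls q)
    (p : ∀ i, (A i).den V) :
    q.den V (ctxVec V (hyp A) (hypVec p) ls) =
      π.den V (ctxVec V (fun s : Slot n => A s.1) (fun s => p s.1) (slots n)) := by
  induction h with
  | base =>
    refine (den_cast _ _ _).trans ?_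
    exact congrArg (π.den V) (castE_ctxVec_map Sum.inl (hyp A) (hypVec p) (slots n) _)
  | exch e h ih => rw [den_exch _ _ _ (exch_den_ctxVec (hyp A) (hypVec p) e), ih]
  | der s h ih =>
    rw [← ih, ctxVec_cons]
    refine (den_der _ _ _).trans ?_
    exact congrArg (fun a => Prf.den V _ (ct a _)) (Bang.d_ket (k := k) (p s.1))
  | ctr i h ih =>
    rw [← ih, ctxVec_cons]
    refine (den_ctr _ _ _).trans ?_
    -- After the comultiplication is replaced by the tensor square, `ct₂` of it followed by the
    -- remaining factors is by definition the pure tensor for the list with the label repeated.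
    exact congrArg (fun a => Prf.den V _ (ct₂ a _))
      (Bang.isGroupLike_ket (k := k) (p i)).comul_eq_tmul_self
  | wk i hn hi h ih =>
    rw [← ih, ctxVec_cons]
    refine (den_wk _ _ _ _).trans ?_
    have e : eps (V := V) (Bang.ket (k := k) (p i)) = 1 :=
      (Bang.isGroupLike_ket (k := k) (p i)).counit_eq_one
    exact (congrArg (· • _) e).trans (one_smul k _)

/-- Invariance under cut-elimination reduces to the case of a proof derived literally from `π`. At
the end of the derivation only the labels of the `!(A i)` are left, where `hypVec p` consists of
vacuum vectors. -/
theorem IsPlainFrom.den_ctxVec {π : Prf ((slots n).map fun s => A s.1) B}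
    {ψ : Prf ((List.finRange r).map fun i => bang (A i)) B} (h : IsPlainFrom A π ψ)
    (p : ∀ i, (A i).den V) :
    ψ.den V (ctxVec V (fun i => bang (A i)) (fun i => Bang.ket (k := k) (p i))
        (List.finRange r)) =
      π.den V (ctxVec V (fun s : Slot n => A s.1) (fun s => p s.1) (slots n)) := by
  obtain ⟨ψ₀, h₀, h⟩ := h
  rw [cutEquiv_den h, ← h₀.den_ctxVec p]
  -- `den_cast` transports the vector against the direction of the cast, whereas `castE_ctxVec_map`
  -- computes the transport along it; `castE_symm_apply` inverts the latter.
  exact (den_cast _ _ _).trans <| congrArg (ψ₀.den V) (castE_symm_apply List.map_map _ _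
    (castE_ctxVec_map Sum.inr (hyp A) (hypVec p) (List.finRange r) List.map_map))

/-- Summing over all of `P` instead of the support of `ω` makes the index set independent of `ω`, as
the multilinear expansion requires. -/
theorem denLin_eq_sum {C : Formula α} (P : Finset (ProofClass [] C)) (ω : P →₀ k) :
    denLin V P ω = ∑ ρ : P, ω ρ • ProofClass.den V ρ.1 := by
  rw [denLin, Finsupp.linearCombination_apply]
  exact Finsupp.sum_fintype _ _ fun ρ => zero_smul k (ProofClass.den V ρ.1)

/-- The central formula: the vacuum vectors turn `⟦ψ⟧` into `⟦π⟧` on repeated arguments,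
multilinearity expands these arguments in the given proofs, and each resulting term is the
denotation of a cut. -/
theorem IsPlainFrom.den_vacuum {π : Prf ((slots n).map fun s => A s.1) B}
    {ψ : Prf ((List.finRange r).map fun i => bang (A i)) B} (h : IsPlainFrom A π ψ)
    (P : ∀ i, Finset (ProofClass [] (A i))) (ω : ∀ i, P i →₀ k) :
    ψ.den V (vacuum V A P ω) = ∑ γ : ∀ i, Fin (n i) → P i,
      (∏ i, ∏ j, ω i (γ i j)) • ProofClass.den V (ProofClass.subst π γ) := by
  rw [vacuum, h.den_ctxVec V]
  simp only [denLin_eq_sum]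
  rw [ctxVec_sum_smul (fun s : Slot n => A s.1) (nodup_slots n) (mem_slots n)
    (fun s ρ => ω s.1 ρ) fun s ρ => ProofClass.den V ρ.1, map_sum]
  -- The expansion is indexed by functions on slots `(i, j)`, the formula by families of functions
  -- `γ i` of `j`; currying matches the two, and `Fintype.prod_sigma` splits the product of
  -- coefficients accordingly.
  refine Fintype.sum_equiv (Equiv.piCurry fun i (_ : Fin (n i)) => P i) _ _ fun γ => ?_
  rw [map_smul, ProofClass.subst, ProofClass.den_plug, Fintype.prod_sigma]
  rfl

end Denotation

/-! ### The polynomial map induced by a plain proof. -/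

section PolynomialMap

variable {k : Type u} [Field k] {α : Type v} {r : ℕ} {n : Fin r → ℕ} {A : Fin r → Formula α}
  {B : Formula α}

/-- The function `F_ψ : k𝒫₁ × ⋯ × k𝒫_r → k𝒬`. -/
noncomputable def plainMap (π : Prf ((slots n).map fun s => A s.1) B)
    (P : ∀ i, Finset (ProofClass [] (A i))) (Q : Finset (ProofClass [] B))
    (hPQ : ∀ γ : ∀ i, Fin (n i) → P i, ProofClass.subst π γ ∈ Q) (ω : ∀ i, P i →₀ k) : Q →₀ k :=
  ∑ γ : ∀ i, Fin (n i) → P i,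
    Finsupp.single ⟨ProofClass.subst π γ, hPQ γ⟩ (∏ i, ∏ j, ω i (γ i j))

/-- By linearity each basis vector goes to the denotation of the proof it names. The outcome is the
right-hand side of `IsPlainFrom.den_vacuum`, so comparing the two gives the defining identity of
`F`. -/
theorem denLin_plainMap (V : α → ModuleCat.{u} k) (π : Prf ((slots n).map fun s => A s.1) B)
    (P : ∀ i, Finset (ProofClass [] (A i))) (Q : Finset (ProofClass [] B))
    (hPQ : ∀ γ : ∀ i, Fin (n i) → P i, ProofClass.subst π γ ∈ Q) (ω : ∀ i, P i →₀ k) :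
    denLin V Q (plainMap π P Q hPQ ω) = ∑ γ : ∀ i, Fin (n i) → P i,
      (∏ i, ∏ j, ω i (γ i j)) • ProofClass.den V (ProofClass.subst π γ) := by
  rw [plainMap, map_sum]
  exact Finset.sum_congr rfl fun γ _ => Finsupp.linearCombination_single ..

/-- Both sides are sums over `γ`, compared term by term: the indicator of `τ = π(γ)` in the
polynomial is the `τ`-coordinate of the basis vector indexed by `π(γ)`. Distinct `γ` giving the same
proof add up on both sides. -/
theorem evalX_plainPoly (π : Prf ((slots n).map fun s => A s.1) B)
    (P : ∀ i, Finset (ProofClass [] (A i))) (Q : Finset (ProofClass [] B))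
    (hPQ : ∀ γ : ∀ i, Fin (n i) → P i, ProofClass.subst π γ ∈ Q) (ω : ∀ i, P i →₀ k) (τ : Q) :
    evalX ω (plainPoly k π P τ.1) = plainMap π P Q hPQ ω τ := by
  classical
  rw [plainPoly, plainMap, map_sum, Finsupp.finsetSum_apply]
  refine Finset.sum_congr rfl fun γ _ => ?_
  rw [Finsupp.single_apply, apply_ite (evalX ω), map_zero, map_prod]
  -- The two conditionals test the same equality in opposite orientations, one of them inside the
  -- subtype of members of `Q`.
  simp only [map_prod, evalX_xVar, Subtype.ext_iff, eq_comm]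

end PolynomialMap

end LinearLogic

/-! ### Existence, uniqueness and polynomiality of the induced map. -/

theorem mainTheorem7 {k : Type u} [Field k] [IsAlgClosed k] {α : Type v}
    (V : α → ModuleCat.{u} k) {r : ℕ} {A : Fin r → LinearLogic.Formula α}
    {B : LinearLogic.Formula α} {n : Fin r → ℕ}
    (π : LinearLogic.Prf ((LinearLogic.slots n).map fun s => A s.1) B)
    (ψ : LinearLogic.Prf ((List.finRange r).map fun i => LinearLogic.Formula.bang (A i)) B)
    (hψ : LinearLogic.IsPlainFrom A π ψ)
    (P : ∀ i, Finset (LinearLogic.ProofClass [] (A i)))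
    (Q : Finset (LinearLogic.ProofClass [] B))
    (hPQ : ∀ γ : ∀ i, Fin (n i) → P i, LinearLogic.ProofClass.subst π γ ∈ Q)
    (hQ : LinearIndependent k fun τ : Q => LinearLogic.ProofClass.den V τ.1) :
    ∃ F : (∀ i, P i →₀ k) → (Q →₀ k),
      (∀ ω, ψ.den V (LinearLogic.vacuum V A P ω) = LinearLogic.denLin V Q (F ω)) ∧
      (∀ F' : (∀ i, P i →₀ k) → (Q →₀ k),
        (∀ ω, ψ.den V (LinearLogic.vacuum V A P ω) = LinearLogic.denLin V Q (F' ω)) → F' = F) ∧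
      ∃ f : SymmetricAlgebra k (Q →₀ k) →ₐ[k]
          SymmetricAlgebra k (DirectSum (Fin r) fun i => P i →₀ k),
        (∀ ω, LinearLogic.evalY (F ω) = (LinearLogic.evalX ω).comp f) ∧
        ∀ τ : Q, f (LinearLogic.yVar k τ) = LinearLogic.plainPoly k π P τ.1 := by
  refine ⟨LinearLogic.plainMap π P Q hPQ, fun ω => ?_, fun F' hF' => ?_,
    -- The morphism is prescribed on the basis of the generating space by the polynomials, and
    -- extended by the universal property of the symmetric algebra.
    SymmetricAlgebra.lift
      (Finsupp.linearCombination k fun τ : Q => LinearLogic.plainPoly k π P τ.1),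
    fun ω => ?_, fun τ => ?_⟩
  · rw [hψ.den_vacuum V, LinearLogic.denLin_plainMap]
  · funext ω
    -- Linear independence is by definition injectivity of the map sending coefficients to the
    -- linear combination of denotations, and that map is `denLin V Q`.
    apply hQ
    change LinearLogic.denLin V Q _ = LinearLogic.denLin V Q _
    rw [← hF', hψ.den_vacuum V, LinearLogic.denLin_plainMap]
  -- Both sides are algebra morphisms to `k` from the symmetric algebra, so it suffices to compare
  -- them on the generators `y_τ`, where the claim is the coordinate formula `evalX_plainPoly`.
  · ext τ
    simp [LinearLogic.evalY, LinearLogic.evalX_plainPoly π P Q hPQ]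
  · simp [LinearLogic.yVar]
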